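/- **Proposition.** Let $n$ be a positive integer and $\alpha=(\alpha_1,\dots,\alpha_\ell)$ a composition of $n$, with $\ell=\ell(\alpha)$. *Weak orders and intervals.* Let $s_i=(i,i+1)$ and let $\ell(\cdot)$ be the Coxeter length on the symmetric group $\mathfrak S_n$; put $\mathrm{Des}_L(\sigma)=\{i\in[n-1] : \ell(s_i\sigma)<\ell(\sigma)\}$ and $\mathrm{Des}_R(\sigma)=\{i\in[n-1]:\ell(\sigma s_i)<\ell(\sigma)\}$. The left (right) weak order $\preceq_L$ ($\preceq_R$) is generated by $\sigma\preceq_L s_i\sigma$ for $i\notin \mathrm{Des}_L(\sigma)$ (by $\sigma\preceq_R\sigma s_i$ for $i\notin\mathrm{Des}_R(\sigma)$). For $\sigma\preceq_L\rho$ put $[\sigma,\rho]_L=\{\gamma:\sigma\preceq_L\gamma\preceq_L\rho\}$, and let $\mathrm{Int}(n)$ be the set of all these intervals. Two intervals are equivalent if there is an isomorphism $f$ between them for $\preceq_L$ with $\mathrm{Des}_L(\gamma)=\mathrm{Des}_L(f(\gamma))$ for all $\gamma$. On an equivalence class $C$ put $[\sigma,\rho]_L\preceq[\sigma',\rho']_L$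 if and only if $\sigma\preceq_R\sigma'$. For $S\subseteq[n-1]$ let $S^{\mathrm c}=[n-1]\setminus S$, let $w_0(S)$ be the longest element of the subgroup generated by $\{s_i:i\in S\}$, and let $w_1(S)$ be the longest element of $\{z\in\mathfrak S_n:\mathrm{Des}_R(z)\subseteq S\}$. Let $\mathrm{set}(\alpha)=\{\alpha_1,\alpha_1+\alpha_2,\dots,\alpha_1+\cdots+\alpha_{\ell-1}\}$. *Diagrams.* The box $(x,y)$ lies in column $x$ from the left and row $y$ from the bottom. A standard filling of an $n$-box diagram $D$ uses each of $1,\dots,n$ once; words in $1,\dots,n$ without repetition are read as permutations in one-line notation. For a standard filling $F$ in which $i$ has position $(x_i,y_i)$, let $P_F$ be the poset on $[n]$ with $i\preceq_{P_F} j$ if and only if $x_i\le x_j$ and $y_i\le y_j$. For a poset $P$ on $[n]$ let $\Sigma_L(P)=\{\sigma\in\mathfrak S_n:\sigma(i)\le\sigma(j)\text{ whenever } i\preceq_P j\}$. Let $\mathrm{ST}(D)$ be the set of standard fillings $T$ of $D$ with $T(i,j)\le T(k,l)$ whenever $i\le k$ and $j\le l$, ordered by $T\le U$ if and only if $\mathrm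 w(T)\preceq_L \mathrm w(U)$, where $\mathrm w$ reads the columns from left to right, each from top to bottom. Let $D^x$ and $T^x$ be the reflections of a diagram $D$ and a filling $T$ in a horizontal line, shifted so that the lowest row is row $1$. *Immaculate tableaux.* The composition diagram $\mathrm{tcd}(\alpha)$ is left-justified with $\alpha_i$ boxes in row $i$. A standard immaculate tableau (SIT) of shape $\alpha$ is a standard filling of $\mathrm{tcd}(\alpha)$ whose rows increase from left to right and whose first column increases from bottom to top. For an SIT $T$ let $\mathrm{read}(T)$ be the word reading the rows from bottom to top, each from right to left, and let $\mathrm{read}'(T)$ be the word reading first the boxes outside the first column, rows from bottom to top and each from right to left, and then the first column from bottom to top. Let $T^{\mathrm{source}}_\alpha$ be the SIT with $1,\dots,n$ filled in from left to right and from bottom to top; let $T^{\mathrm{sink}}_\alpha$ be the SIT whose first column is $1,\dots,\ell$ from bottom to top and whose other boxes are filled with $\ell+1,\dots,n$ from left to right in each row, starting from the topmost row. The SITs of shape $\alpha$ form the tableau basis of the dual immaculate module $\mathcal V_\alpha$; let $C_{\mathcal V_\alpha}$ be the equivalence class of the set $\{\mathrm{read}(T): T \text{ an SIT of shape }\alpha\}$,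 which belongs to $\mathrm{Int}(n)$. Put $k_i=\sum_{i<r\le\ell}(\alpha_r-1)$ and $$\mathscr D=\{(i,1) : (1,i)\in\mathrm{tcd}(\alpha)\}\cup\{(i,j+k_i) : (j,i)\in\mathrm{tcd}(\alpha),\ j\ge2\}.$$ Then: (a) $C_{\mathcal V_\alpha}=\{\Sigma_L(P_{T^x}) : T\in\mathrm{ST}(\mathscr D^x)\}$; furthermore $$\min C_{\mathcal V_\alpha}=[w_0(\mathrm{set}(\alpha)^{\mathrm c}),\ \mathrm{read}(T^{\mathrm{sink}}_\alpha)]_L\quad\text{and}\quad \max C_{\mathcal V_\alpha}=[\mathrm{read}'(T^{\mathrm{source}}_\alpha),\ w_1([n-\ell(\alpha)])]_L$$ with respect to $\preceq$. (b) $(C_{\mathcal V_\alpha},\preceq)\cong(\mathrm{ST}(\mathscr D^x),\le)$ as posets. -/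

import Mathlib

namespace WeakBruhat

open Equiv

/-! ### The symmetric group and its weak orders

`Perm (Fin n)` is the symmetric group `𝔖_n`: the element `a : Fin n` stands for the letter `a + 1`
of `[n] = {1, …, n}`, and `i : Fin (n - 1)` stands for the index `i + 1` of `[n - 1]`.
Products are compositions of maps, `(σ * ρ) k = σ (ρ k)`. -/

/-- The simple transposition `s_i = (i, i+1)`. -/
def simple {n : ℕ} (i : Fin (n - 1)) : Perm (Fin n) :=
  swap ⟨i, by omega⟩ ⟨i + 1, by omega⟩

/-- The length of `σ`: the minimal number of factors in an expression of `σ` as a product of simple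
transpositions. -/
noncomputable def len {n : ℕ} (σ : Perm (Fin n)) : ℕ :=
  sInf {k | ∃ l : List (Fin (n - 1)), l.length = k ∧ (l.map simple).prod = σ}

/-- Left descent set. -/
def leftDescents {n : ℕ} (σ : Perm (Fin n)) : Set (Fin (n - 1)) :=
  {i | len (simple i * σ) < len σ}

/-- Right descent set. -/
def rightDescents {n : ℕ} (σ : Perm (Fin n)) : Set (Fin (n - 1)) :=
  {i | len (σ * simple i) < len σ}

/-- Left weak order, generated by `σ ≼ s_i σ` for `i` not a left descent of `σ`. -/
def LeftLE {n : ℕ} : Perm (Fin n) → Perm (Fin n) → Prop :=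
  Relation.ReflTransGen fun σ τ => ∃ i, i ∉ leftDescents σ ∧ τ = simple i * σ

/-- Right weak order, generated by `σ ≼ σ s_i` for `i` not a right descent of `σ`. -/
def RightLE {n : ℕ} : Perm (Fin n) → Perm (Fin n) → Prop :=
  Relation.ReflTransGen fun σ τ => ∃ i, i ∉ rightDescents σ ∧ τ = σ * simple i

/-- `[σ, ρ]_L` as a set of permutations. -/
def leftInterval {n : ℕ} (σ ρ : Perm (Fin n)) : Set (Perm (Fin n)) :=
  {γ | LeftLE σ γ ∧ LeftLE γ ρ}

/-- `I ∈ Int(n)`: `I` is a nonempty left weak Bruhat interval. -/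
def IsInterval {n : ℕ} (I : Set (Perm (Fin n))) : Prop :=
  ∃ σ ρ, LeftLE σ ρ ∧ I = leftInterval σ ρ

/-- There is a descent-preserving isomorphism `(I, ≼_L) ≃ (J, ≼_L)`. -/
def DescentEquiv {n : ℕ} (I J : Set (Perm (Fin n))) : Prop :=
  ∃ f : I ≃ J, (∀ γ δ : I, LeftLE (γ : Perm (Fin n)) δ ↔ LeftLE (f γ : Perm (Fin n)) (f δ)) ∧
    ∀ γ : I, leftDescents (γ : Perm (Fin n)) = leftDescents (f γ : Perm (Fin n))

/-- `[σ, ρ]_L ⪯ [σ', ρ']_L` if and only if `σ ≼_R σ'`. -/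
def IntervalLE {n : ℕ} (I J : Set (Perm (Fin n))) : Prop :=
  ∃ σ ρ σ' ρ', LeftLE σ ρ ∧ I = leftInterval σ ρ ∧ LeftLE σ' ρ' ∧ J = leftInterval σ' ρ' ∧
    RightLE σ σ'

theorem exists_longest {n : ℕ} (A : Set (Perm (Fin n))) (hA : A.Nonempty) :
    ∃ w ∈ A, ∀ u ∈ A, len u ≤ len w :=
  Set.exists_max_image A len A.toFinite hA

/-- An element of maximal length of a nonempty set of permutations. -/
noncomputable def longest {n : ℕ} (A : Set (Perm (Fin n))) (hA : A.Nonempty) : Perm (Fin n) :=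
  (exists_longest A hA).choose

/-- The parabolic subgroup `𝔖_S`, generated by the `s_i` with `i ∈ S`. -/
def parabolic {n : ℕ} (S : Set (Fin (n - 1))) : Subgroup (Perm (Fin n)) :=
  Subgroup.closure (simple '' S)

/-- `w_0(S)`: the longest element of `𝔖_S`. -/
noncomputable def w0 {n : ℕ} (S : Set (Fin (n - 1))) : Perm (Fin n) :=
  longest (parabolic S : Set (Perm (Fin n))) ⟨1, (parabolic S).one_mem⟩

/-- `𝔖^S`: the minimal length representatives of the left cosets of `𝔖_S`. -/
def minimalReps {n : ℕ} (S : Set (Fin (n - 1))) : Set (Perm (Fin n)) :=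
  {z | rightDescents z ⊆ Sᶜ}

theorem one_mem_minimalReps {n : ℕ} (S : Set (Fin (n - 1))) :
    (1 : Perm (Fin n)) ∈ minimalReps S := by
  have h : len (1 : Perm (Fin n)) = 0 := Nat.sInf_eq_zero.2 (Or.inl ⟨[], rfl, rfl⟩)
  intro i hi
  simp [rightDescents, h] at hi

/-- `w_1(S)`: the longest element of `𝔖^{Sᶜ}`. -/
noncomputable def w1 {n : ℕ} (S : Set (Fin (n - 1))) : Perm (Fin n) :=
  longest (minimalReps Sᶜ) ⟨1, one_mem_minimalReps _⟩

/-- `Σ_L(P)` for a partial order `P` on `[n]`. -/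
def sigmaL {n : ℕ} (P : PartialOrder (Fin n)) : Set (Perm (Fin n)) :=
  {σ | ∀ i j, P.le i j → σ i ≤ σ j}

/-! ### Diagrams and fillings

The box `(x, y)` lies in column `x` (from the left) and row `y` (from the bottom), counted from `1`.
A standard filling of `D` is a bijection `D ≃ Fin n`. -/

/-- The bijection from the boxes of `D` to `Fin n` that numbers them increasingly with respect to
`key`. -/
noncomputable def numberBy {n : ℕ} {L : Type*} [LinearOrder L] (key : ℕ × ℕ ↪ L) (D : Finset (ℕ × ℕ))
    (hD : D.card = n) : D ≃ Fin n :=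
  (Equiv.ofBijective
    (fun b : D => (⟨key b, Finset.mem_map_of_mem key b.2⟩ : ↥(D.map key)))
    ⟨fun _ _ h => Subtype.ext (key.injective (congrArg Subtype.val h)), fun ⟨c, hc⟩ => by
      obtain ⟨b, hb, rfl⟩ := Finset.mem_map.1 hc
      exact ⟨⟨b, hb⟩, rfl⟩⟩).trans
  ((D.map key).orderIsoOfFin (by simpa using hD)).toEquiv.symm

/-- The reading word of a standard filling, as a permutation: the value at `k` is the entry of the
`k`-th box with respect to `key`. -/
noncomputable def readBy {n : ℕ} {L : Type*} [LinearOrder L] (key : ℕ × ℕ ↪ L) {D : Finset (ℕ × ℕ)}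
    (T : D ≃ Fin n) : Perm (Fin n) :=
  (numberBy key D (by simpa using Fintype.card_congr T)).symm.trans T

/-- Columns from left to right, each from top to bottom. -/
def keyTBLR : ℕ × ℕ ↪ ℕ ×ₗ ℕᵒᵈ :=
  ⟨fun b => toLex (b.1, OrderDual.toDual b.2), fun a b h => by simpa [Prod.ext_iff] using h⟩

/-- Rows from bottom to top, each from right to left. -/
def keyRLBT : ℕ × ℕ ↪ ℕ ×ₗ ℕᵒᵈ :=
  ⟨fun b => toLex (b.2, OrderDual.toDual b.1), fun a b h => by
    simpa [Prod.ext_iff, and_comm] using h⟩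

/-- Rows from bottom to top, each from left to right. -/
def keyLRBT : ℕ × ℕ ↪ ℕ ×ₗ ℕ :=
  ⟨fun b => toLex (b.2, b.1), fun a b h => by simpa [Prod.ext_iff, and_comm] using h⟩

/-- First the boxes outside the first column, rows from bottom to top and each from right to left;
then the boxes of the first column from bottom to top. -/
def keyRLBTBT : ℕ × ℕ ↪ (ℕ ×ₗ ℕᵒᵈ) ⊕ₗ ℕ :=
  ⟨fun b => if b.1 = 1 then toLex (Sum.inr b.2)
      else toLex (Sum.inl (toLex (b.2, OrderDual.toDual b.1))), fun a b h => by
    by_cases ha : a.1 = 1 <;> by_cases hb : b.1 = 1 <;>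
      simp_all [Prod.ext_iff]⟩

/-- First the boxes of the first column from bottom to top; then the other boxes, rows from top to
bottom and each from left to right. -/
def keySink : ℕ × ℕ ↪ ℕ ⊕ₗ (ℕᵒᵈ ×ₗ ℕ) :=
  ⟨fun b => if b.1 = 1 then toLex (Sum.inl b.2)
      else toLex (Sum.inr (toLex (OrderDual.toDual b.2, b.1))), fun a b h => by
    by_cases ha : a.1 = 1 <;> by_cases hb : b.1 = 1 <;>
      simp_all [Prod.ext_iff]⟩

/-- The poset `P_F` on `[n]`: `i ≼ j` if and only if `x_i ≤ x_j` and `y_i ≤ y_j`, where `(x_i, y_i)`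
is the position of `i` in `F`. -/
@[reducible] def diagramPoset {n : ℕ} {D : Finset (ℕ × ℕ)} (F : D ≃ Fin n) : PartialOrder (Fin n) :=
  PartialOrder.lift (fun i => ((F.symm i : D) : ℕ × ℕ))
    (Subtype.val_injective.comp F.symm.injective)

/-- Reflection of the boxes of `D` in a horizontal line, exchanging the row `1` with the topmost
row of `D`. -/
def flipBox (D : Finset (ℕ × ℕ)) (b : ℕ × ℕ) : ℕ × ℕ :=
  (b.1, D.sup Prod.snd + 1 - b.2)

/-- The reflected diagram `D^x`. -/
def reflect (D : Finset (ℕ × ℕ)) : Finset (ℕ × ℕ) :=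
  D.image (flipBox D)

theorem flipBox_injOn (D : Finset (ℕ × ℕ)) {a b : ℕ × ℕ} (ha : a ∈ D) (hb : b ∈ D)
    (h : flipBox D a = flipBox D b) : a = b := by
  have h1 : a.2 ≤ D.sup Prod.snd := Finset.le_sup (f := Prod.snd) ha
  have h2 : b.2 ≤ D.sup Prod.snd := Finset.le_sup (f := Prod.snd) hb
  simp only [flipBox, Prod.mk.injEq] at h
  exact Prod.ext h.1 (by omega)

/-- The bijection between the boxes of `D` and those of `D^x`. -/
noncomputable def reflectEquiv (D : Finset (ℕ × ℕ)) : D ≃ reflect D :=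
  Equiv.ofBijective (fun b => ⟨flipBox D b, Finset.mem_image_of_mem _ b.2⟩)
    ⟨fun a b h => Subtype.ext (flipBox_injOn D a.2 b.2 (congrArg Subtype.val h)), fun ⟨c, hc⟩ => by
      obtain ⟨b, hb, rfl⟩ := Finset.mem_image.1 hc
      exact ⟨⟨b, hb⟩, rfl⟩⟩

/-- The reflected filling `F^x`. -/
noncomputable def reflectFilling {n : ℕ} {D : Finset (ℕ × ℕ)} (F : D ≃ Fin n) :
    reflect D ≃ Fin n :=
  (reflectEquiv D).symm.trans F

/-- `ST(D)`: the standard tableaux on `D`. -/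
def StandardTableau (n : ℕ) (D : Finset (ℕ × ℕ)) : Type :=
  {T : D ≃ Fin n // ∀ b c : D, b.1.1 ≤ c.1.1 → b.1.2 ≤ c.1.2 → T b ≤ T c}

/-- The order on `ST(D)`: left weak order of the top-to-bottom, left-to-right reading words. -/
def TableauLE {n : ℕ} {D : Finset (ℕ × ℕ)} (T U : StandardTableau n D) : Prop :=
  LeftLE (readBy keyTBLR T.1) (readBy keyTBLR U.1)

/-! ### Compositions and standard immaculate tableaux -/

/-- `set(α) = {α_1, α_1 + α_2, …, α_1 + ⋯ + α_{ℓ(α)-1}} ⊆ [n-1]`. -/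
def compSet {n : ℕ} (α : Composition n) : Set (Fin (n - 1)) :=
  {i | ∃ k, 1 ≤ k ∧ k < α.length ∧ α.sizeUpTo k = (i : ℕ) + 1}

/-- The composition diagram `tcd(α)`: row `i` (from the bottom) has `α_i` boxes. -/
def compDiagram {n : ℕ} (α : Composition n) : Finset (ℕ × ℕ) :=
  (Finset.univ : Finset (Σ i : Fin α.length, Fin (α.blocksFun i))).map
    ⟨fun p => ((p.2 : ℕ) + 1, (p.1 : ℕ) + 1), by
      rintro ⟨i, j⟩ ⟨i', j'⟩ h
      simp only [Prod.mk.injEq, add_left_inj] at h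
      obtain ⟨h1, h2⟩ := h
      obtain rfl := Fin.ext h2
      obtain rfl := Fin.ext h1
      rfl⟩

theorem card_compDiagram {n : ℕ} (α : Composition n) : (compDiagram α).card = n := by
  simp [compDiagram]

/-- The standard immaculate tableaux of shape `α`: entries increase from left to right in each row
and from bottom to top in the first column. -/
def IsImmaculate {n : ℕ} {α : Composition n} (T : compDiagram α ≃ Fin n) : Prop :=
  (∀ b c : compDiagram α, b.1.2 = c.1.2 → b.1.1 < c.1.1 → T b < T c) ∧
    ∀ b c : compDiagram α, b.1.1 = 1 → c.1.1 = 1 → b.1.2 < c.1.2 → T b < T c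

/-- The filling of `tcd(α)` by `1, …, n` from left to right and from bottom to top. -/
noncomputable def sourceSIT {n : ℕ} (α : Composition n) : compDiagram α ≃ Fin n :=
  numberBy keyLRBT (compDiagram α) (card_compDiagram α)

/-- The filling of `tcd(α)` by `1, …, n`, first in the first column from bottom to top, then in the
remaining boxes, row by row from the topmost row, each from left to right. -/
noncomputable def sinkSIT {n : ℕ} (α : Composition n) : compDiagram α ≃ Fin n :=
  numberBy keySink (compDiagram α) (card_compDiagram α)

/-- The set of reading words (rows from bottom to top, each from right to left) of the standard
immaculate tableaux of shape `α`, which form the tableau basis of the module `V_α`. -/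
def readingWords {n : ℕ} (α : Composition n) : Set (Perm (Fin n)) :=
  {σ | ∃ T : compDiagram α ≃ Fin n, IsImmaculate T ∧ σ = readBy keyRLBT T}

/-- The class `C_{V_α}`: the intervals equivalent to the interval of reading words. -/
def immaculateClass {n : ℕ} (α : Composition n) : Set (Set (Perm (Fin n))) :=
  {J | IsInterval J ∧ DescentEquiv (readingWords α) J}

/-- `k_i = ∑_{i < r ≤ ℓ(α)} (α_r - 1)`. -/
def shift {n : ℕ} (α : Composition n) (i : ℕ) : ℕ :=
  ∑ r ∈ (Finset.univ : Finset (Fin α.length)).filter (fun r => i < r.val + 1), (α.blocksFun r - 1)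

/-- The diagram `{(i, 1) | (1, i) ∈ tcd(α)} ∪ {(i, j + k_i) | (j, i) ∈ tcd(α), j ≥ 2}`. -/
def immaculateDiagram {n : ℕ} (α : Composition n) : Finset (ℕ × ℕ) :=
  ((compDiagram α).filter fun b => b.1 = 1).image (fun b => (b.2, 1)) ∪
    ((compDiagram α).filter fun b => 2 ≤ b.1).image (fun b => (b.2, b.1 + shift α b.2))

end WeakBruhat

namespace WeakBruhat

open Equiv

/-! ### Inversions -/

/-! Since inversions are recorded as pairs of positions, `LeftLE` is inclusion of inversion sets
(`leftLE_iff`). A descent-preserving isomorphism of left intervals keeps the label of every cover,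
hence is a right translation (`apply_eq_mul`). So each member of the class consists of the same
immaculate tableaux, with the boxes read in another order `L`: it is `words L`.

Two orders on the boxes decide which `L` occur: `BoxLE` constrains the entries, `IsAdmissible` the
reading order. With the row in `tcd(α)` as abscissa and `height` as ordinate, which is the picture
of the diagram 𝒟, they are the north-east and the south-east order, so any two boxes are comparable
in at least one of them. Therefore an admissible `L` makes `words L` the interval from the source to
the sink (`words_eq_leftInterval`). Admissible numberings differ only on pairs whose order is the
same in every immaculate tableau and whose entries are never consecutive, so their intervals are
equivalent. Conversely, the descents of source and sink force admissibility. This gives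
`immaculateClass_eq`.

Reflection turns south-east into north-east, so admissible numberings are the standard tableaux on
the reflected diagram. The column word of a tableau is the inverse of the minimum of its interval
(`readBy_keyTBLR`), which converts `RightLE` into `LeftLE`. Relative to the source, `readingNumber`
inverts only the pairs that every admissible numbering inverts, and `reading'Number` every pair that
some admissible numbering inverts; these are the extremes. -/

/-- The inversions of `σ`, as pairs of positions. -/
def inversions {n : ℕ} (σ : Perm (Fin n)) : Finset (Fin n × Fin n) :=
  Finset.univ.filter fun p => p.1 < p.2 ∧ σ p.2 < σ p.1

theorem mem_inversions {n : ℕ} {σ : Perm (Fin n)} {p q : Fin n} :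
    (p, q) ∈ inversions σ ↔ p < q ∧ σ q < σ p := by
  simp [inversions]

/-- The lower of the two letters exchanged by `simple i`. -/
def lo {n : ℕ} (i : Fin (n - 1)) : Fin n := ⟨i, by omega⟩

/-- The upper of the two letters exchanged by `simple i`. -/
def hi {n : ℕ} (i : Fin (n - 1)) : Fin n := ⟨i + 1, by omega⟩

theorem lo_lt_hi {n : ℕ} (i : Fin (n - 1)) : lo i < hi i := by
  simp [lo, hi, Fin.lt_def]

theorem exists_lo_hi {n : ℕ} {x y : Fin n} (h : (y : ℕ) = x + 1) :
    ∃ i : Fin (n - 1), x = lo i ∧ y = hi i :=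
  ⟨⟨x, by omega⟩, rfl, Fin.ext h⟩

theorem simple_eq_swap {n : ℕ} (i : Fin (n - 1)) : simple i = swap (lo i) (hi i) := rfl

theorem simple_mul_simple {n : ℕ} (i : Fin (n - 1)) : simple i * simple i = 1 :=
  swap_mul_self _ _

theorem simple_mul_cancel_left {n : ℕ} (i : Fin (n - 1)) (σ : Perm (Fin n)) :
    simple i * (simple i * σ) = σ := by
  rw [← mul_assoc, simple_mul_simple, one_mul]

theorem simple_inv {n : ℕ} (i : Fin (n - 1)) : (simple i)⁻¹ = simple i :=
  swap_inv _ _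

/-- No letter lies strictly between `lo i` and `hi i`, so exchanging them affects no other
comparison. -/
theorem simple_lt_simple {n : ℕ} (i : Fin (n - 1)) {u v : Fin n}
    (h1 : ¬(u = lo i ∧ v = hi i)) (h2 : ¬(u = hi i ∧ v = lo i)) :
    simple i u < simple i v ↔ u < v := by
  rw [simple_eq_swap, swap_apply_def, swap_apply_def]
  simp only [Fin.ext_iff, lo, hi] at h1 h2
  split_ifs <;> simp only [Fin.ext_iff, Fin.lt_def, lo, hi] at * <;> omega

theorem inversions_simple_mul {n : ℕ} (i : Fin (n - 1)) (σ : Perm (Fin n))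
    (h : σ⁻¹ (lo i) < σ⁻¹ (hi i)) :
    inversions (simple i * σ) = insert (σ⁻¹ (lo i), σ⁻¹ (hi i)) (inversions σ) := by
  ext ⟨p, q⟩
  rw [Finset.mem_insert, mem_inversions, mem_inversions, Prod.mk.injEq, Perm.mul_apply,
    Perm.mul_apply, Perm.eq_inv_iff_eq, Perm.eq_inv_iff_eq]
  by_cases h1 : σ p = lo i ∧ σ q = hi i
  · have hp : p = σ⁻¹ (lo i) := Perm.eq_inv_iff_eq.2 h1.1
    have hq : q = σ⁻¹ (hi i) := Perm.eq_inv_iff_eq.2 h1.2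
    simp only [h1, and_self, true_or, iff_true, simple_eq_swap, swap_apply_left,
      swap_apply_right, lo_lt_hi, and_true]
    rwa [hp, hq]
  · by_cases h2 : σ p = hi i ∧ σ q = lo i
    · have hp : p = σ⁻¹ (hi i) := Perm.eq_inv_iff_eq.2 h2.1
      have hq : q = σ⁻¹ (lo i) := Perm.eq_inv_iff_eq.2 h2.2
      have : ¬ p < q := by rw [hp, hq]; exact h.asymm
      simp [this, h1]
    · rw [simple_lt_simple i (fun h => h2 h.symm) (fun h => h1 h.symm)]
      simp [h1]

theorem not_mem_inversions_of_lt {n : ℕ} (i : Fin (n - 1)) (σ : Perm (Fin n)) :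
    (σ⁻¹ (lo i), σ⁻¹ (hi i)) ∉ inversions σ := by
  simp [mem_inversions, (lo_lt_hi i).le]

theorem card_inversions_simple_mul {n : ℕ} (i : Fin (n - 1)) (σ : Perm (Fin n))
    (h : σ⁻¹ (lo i) < σ⁻¹ (hi i)) :
    (inversions (simple i * σ)).card = (inversions σ).card + 1 := by
  rw [inversions_simple_mul i σ h, Finset.card_insert_of_notMem (not_mem_inversions_of_lt i σ)]

theorem card_inversions_simple_mul' {n : ℕ} (i : Fin (n - 1)) (σ : Perm (Fin n))
    (h : σ⁻¹ (hi i) < σ⁻¹ (lo i)) :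
    (inversions σ).card = (inversions (simple i * σ)).card + 1 := by
  have := card_inversions_simple_mul i (simple i * σ) (by
    simpa [simple_eq_swap, mul_inv_rev, swap_inv] using h)
  rwa [simple_mul_cancel_left] at this

/-- A transitive relation that holds between the values at adjacent places holds throughout. -/
theorem rel_of_adjacent {n : ℕ} {β : Type*} {r : β → β → Prop}
    (hr : ∀ {x y z}, r x y → r y z → r x z) (g : Fin n → β) {p q : Fin n} (hpq : p < q)
    (h : ∀ x y : Fin n, p ≤ x → (y : ℕ) = x + 1 → y ≤ q → r (g x) (g y)) : r (g p) (g q) := by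
  obtain ⟨d, hd⟩ := Nat.exists_eq_add_of_lt (Fin.lt_def.1 hpq)
  induction d generalizing q with
  | zero => exact h p q le_rfl hd le_rfl
  | succ d ih =>
    let q' : Fin n := ⟨p + d + 1, by omega⟩
    have hq' : q' < q := by rw [Fin.lt_def]; simp only [q']; omega
    refine hr (ih (q := q') (by rw [Fin.lt_def]; simp only [q']; omega)
      (fun x y hx hxy hy => h x y hx hxy (hy.trans hq'.le)) rfl) (h q' q ?_ ?_ le_rfl)
    · rw [Fin.le_def]; simp only [q']; omega
    · simp only [q']; omega

theorem eq_one_of_adjacent {n : ℕ} (σ : Perm (Fin n))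
    (h : ∀ i : Fin (n - 1), σ (lo i) < σ (hi i)) : σ = 1 := by
  have hm : StrictMono σ := fun p q hpq =>
    rel_of_adjacent (r := (· < ·)) (fun h1 h2 => h1.trans h2) σ hpq fun x y _ hxy _ => by
      obtain ⟨i, rfl, rfl⟩ := exists_lo_hi hxy
      exact h i
  let e : Fin n ≃o Fin n := hm.orderIsoOfSurjective σ σ.surjective
  ext x
  have : e = OrderIso.refl _ := Subsingleton.elim _ _
  exact congrArg (fun f : Fin n ≃o Fin n => (f x : ℕ)) this

theorem exists_descent {n : ℕ} {σ : Perm (Fin n)} (h : σ ≠ 1) :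
    ∃ i : Fin (n - 1), σ (hi i) < σ (lo i) := by
  by_contra! hc
  refine h (eq_one_of_adjacent σ fun i => lt_of_le_of_ne (hc i) fun h => ?_)
  exact (lo_lt_hi i).ne (σ.injective h)

theorem inversions_one {n : ℕ} : inversions (1 : Perm (Fin n)) = ∅ := by
  ext ⟨p, q⟩
  simp only [mem_inversions, Perm.coe_one, id_eq, Finset.notMem_empty, iff_false]
  exact fun h => h.1.asymm h.2

theorem eq_one_of_inversions {n : ℕ} {σ : Perm (Fin n)} (h : inversions σ = ∅) : σ = 1 := by
  by_contra hne
  obtain ⟨i, hi'⟩ := exists_descent hne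
  have := mem_inversions.2 ⟨lo_lt_hi i, hi'⟩
  rw [h] at this
  simp at this

/-- Stripping a left descent removes exactly one inversion. -/
theorem exists_word {n : ℕ} (σ : Perm (Fin n)) :
    ∃ l : List (Fin (n - 1)), l.length = (inversions σ).card ∧ (l.map simple).prod = σ := by
  obtain ⟨k, hk⟩ : ∃ k, k = (inversions σ).card := ⟨_, rfl⟩
  induction k generalizing σ with
  | zero =>
    rw [eq_one_of_inversions (Finset.card_eq_zero.1 hk.symm), inversions_one]
    exact ⟨[], rfl, rfl⟩
  | succ k ih =>
    have hne : σ⁻¹ ≠ 1 := by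
      rintro h
      rw [inv_eq_one.1 h, inversions_one] at hk
      simp at hk
    obtain ⟨i, hi'⟩ := exists_descent hne
    have hc := card_inversions_simple_mul' i σ hi'
    obtain ⟨l, hl, hp⟩ := ih (simple i * σ) (by omega)
    refine ⟨i :: l, by simp [hl, hc], ?_⟩
    rw [List.map_cons, List.prod_cons, hp, simple_mul_cancel_left]

theorem card_inversions_prod_le {n : ℕ} (l : List (Fin (n - 1))) :
    (inversions (l.map simple).prod).card ≤ l.length := by
  induction l with
  | nil => simp [inversions_one]
  | cons i l ih =>
    rw [List.map_cons, List.prod_cons, List.length_cons]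
    rcases lt_or_gt_of_ne
      (fun h => (lo_lt_hi i).ne ((l.map simple).prod⁻¹.injective h)) with h | h
    · rw [card_inversions_simple_mul i _ h]
      omega
    · have := card_inversions_simple_mul' i _ h
      omega

/-- The length is the number of inversions. -/
theorem len_eq_card {n : ℕ} (σ : Perm (Fin n)) : len σ = (inversions σ).card := by
  apply le_antisymm (Nat.sInf_le (exists_word σ))
  obtain ⟨l, hl, hp⟩ := Nat.sInf_mem
    (s := {k | ∃ l : List (Fin (n - 1)), l.length = k ∧ (l.map simple).prod = σ})
    ⟨_, exists_word σ⟩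
  calc (inversions σ).card = (inversions (l.map simple).prod).card := by rw [hp]
    _ ≤ l.length := card_inversions_prod_le l
    _ = len σ := hl

/-- A left descent means that the upper of two consecutive letters stands to the left of the lower
one. -/
theorem mem_leftDescents {n : ℕ} {σ : Perm (Fin n)} {i : Fin (n - 1)} :
    i ∈ leftDescents σ ↔ σ⁻¹ (hi i) < σ⁻¹ (lo i) := by
  change len (simple i * σ) < len σ ↔ _
  rw [len_eq_card, len_eq_card]
  rcases lt_or_gt_of_ne (fun h => (lo_lt_hi i).ne (σ⁻¹.injective h)) with h | h
  · have := card_inversions_simple_mul i _ h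
    simp only [h.asymm, iff_false]
    omega
  · have := card_inversions_simple_mul' i _ h
    simp only [h, iff_true]
    omega

theorem not_mem_leftDescents {n : ℕ} {σ : Perm (Fin n)} {i : Fin (n - 1)} :
    i ∉ leftDescents σ ↔ σ⁻¹ (lo i) < σ⁻¹ (hi i) := by
  rw [mem_leftDescents, not_lt, le_iff_lt_or_eq, or_iff_left]
  exact fun h => (lo_lt_hi i).ne (σ⁻¹.injective h)

theorem len_inv {n : ℕ} (σ : Perm (Fin n)) : len σ⁻¹ = len σ := by
  have key (σ : Perm (Fin n)) : len σ⁻¹ ≤ len σ := by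
    obtain ⟨l, hl, hp⟩ := exists_word σ
    rw [len_eq_card σ, ← hl]
    refine Nat.sInf_le ⟨l.reverse, by simp, ?_⟩
    rw [← hp, List.prod_inv_reverse, List.map_reverse, List.map_map]
    congr 2
  exact (key σ).antisymm (by simpa using key σ⁻¹)

theorem rightDescents_eq {n : ℕ} (σ : Perm (Fin n)) : rightDescents σ = leftDescents σ⁻¹ := by
  ext i
  change len (σ * simple i) < len σ ↔ len (simple i * σ⁻¹) < len σ⁻¹
  rw [← len_inv (σ * simple i), mul_inv_rev, simple_inv, len_inv σ]

theorem mem_rightDescents {n : ℕ} {σ : Perm (Fin n)} {i : Fin (n - 1)} :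
    i ∈ rightDescents σ ↔ σ (hi i) < σ (lo i) := by
  rw [rightDescents_eq, mem_leftDescents, inv_inv]

/-! ### The weak orders in terms of inversions -/

/-- A descent `i` of `τ * σ⁻¹` is a pair of positions holding consecutive letters in `σ` and
inverted in `τ`. It cannot already be inverted in `σ`, so it can be added without leaving the
inversions of `τ`. -/
theorem exists_step {n : ℕ} {σ τ : Perm (Fin n)} (h : inversions σ ⊆ inversions τ) (hne : σ ≠ τ) :
    ∃ i, i ∉ leftDescents σ ∧ inversions (simple i * σ) ⊆ inversions τ := by
  have hne' : τ * σ⁻¹ ≠ 1 := fun h => hne (mul_inv_eq_one.1 h).symm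
  obtain ⟨i, hi'⟩ := exists_descent hne'
  rw [Perm.mul_apply, Perm.mul_apply] at hi'
  have hd : i ∉ leftDescents σ := by
    intro hd
    rw [mem_leftDescents] at hd
    have := (mem_inversions.1 (h (mem_inversions.2 ⟨hd, by simp [lo_lt_hi]⟩))).2
    exact this.asymm hi'
  refine ⟨i, hd, ?_⟩
  rw [not_mem_leftDescents] at hd
  rw [inversions_simple_mul i σ hd]
  exact Finset.insert_subset (mem_inversions.2 ⟨hd, hi'⟩) h

theorem leftLE_iff {n : ℕ} {σ τ : Perm (Fin n)} : LeftLE σ τ ↔ inversions σ ⊆ inversions τ := by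
  constructor
  · intro h
    induction h with
    | refl => exact Finset.Subset.refl _
    | tail _ hst ih =>
      obtain ⟨i, hi', rfl⟩ := hst
      rw [inversions_simple_mul i _ (not_mem_leftDescents.1 hi')]
      exact ih.trans (Finset.subset_insert _ _)
  · intro h
    obtain ⟨k, hk⟩ : ∃ k, k = (inversions τ).card - (inversions σ).card := ⟨_, rfl⟩
    induction k using Nat.strong_induction_on generalizing σ with
    | _ k ih =>
      by_cases hne : σ = τ
      · exact hne ▸ Relation.ReflTransGen.refl
      · obtain ⟨i, hd, hs⟩ := exists_step h hne
        have hc := card_inversions_simple_mul i σ (not_mem_leftDescents.1 hd)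
        have hle := Finset.card_le_card hs
        exact Relation.ReflTransGen.head ⟨i, hd, rfl⟩ (ih _ (by omega) hs rfl)

theorem inversions_injective {n : ℕ} {σ τ : Perm (Fin n)} (h : inversions σ = inversions τ) :
    σ = τ := by
  by_contra hne
  obtain ⟨i, hd, hs⟩ := exists_step h.subset hne
  have hc := card_inversions_simple_mul i σ (not_mem_leftDescents.1 hd)
  have hle := Finset.card_le_card hs
  rw [h] at hc
  omega

theorem LeftLE.refl {n : ℕ} (σ : Perm (Fin n)) : LeftLE σ σ := Relation.ReflTransGen.refl

theorem LeftLE.trans {n : ℕ} {σ τ ρ : Perm (Fin n)} (h1 : LeftLE σ τ) (h2 : LeftLE τ ρ) :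
    LeftLE σ ρ := Relation.ReflTransGen.trans h1 h2

theorem LeftLE.antisymm {n : ℕ} {σ τ : Perm (Fin n)} (h1 : LeftLE σ τ) (h2 : LeftLE τ σ) :
    σ = τ :=
  inversions_injective ((leftLE_iff.1 h1).antisymm (leftLE_iff.1 h2))

theorem rightLE_iff {n : ℕ} {σ τ : Perm (Fin n)} : RightLE σ τ ↔ LeftLE σ⁻¹ τ⁻¹ := by
  constructor
  · refine Relation.ReflTransGen.lift (fun a : Perm (Fin n) => a⁻¹) ?_ _ _
    rintro a _ ⟨i, hi', rfl⟩
    exact ⟨i, by rwa [← rightDescents_eq], by simp [simple_inv]⟩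
  · intro h
    have := Relation.ReflTransGen.lift
      (p := fun σ τ : Perm (Fin n) => ∃ i, i ∉ rightDescents σ ∧ τ = σ * simple i)
      (fun a : Perm (Fin n) => a⁻¹) (by
        rintro a _ ⟨i, hi', rfl⟩
        exact ⟨i, by rwa [rightDescents_eq, inv_inv], by simp [simple_inv]⟩) _ _ h
    simpa [Function.onFun, RightLE] using this

/-! ### Intervals and longest elements -/

theorem leftInterval_injective {n : ℕ} {σ ρ σ' ρ' : Perm (Fin n)} (h : LeftLE σ ρ)
    (h' : LeftLE σ' ρ') (he : leftInterval σ ρ = leftInterval σ' ρ') : σ = σ' := by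
  have h1 : σ ∈ leftInterval σ' ρ' := he ▸ ⟨LeftLE.refl _, h⟩
  have h2 : σ' ∈ leftInterval σ ρ := he ▸ ⟨LeftLE.refl _, h'⟩
  exact h2.1.antisymm h1.1

theorem intervalLE_iff {n : ℕ} {σ ρ σ' ρ' : Perm (Fin n)} (h : LeftLE σ ρ) (h' : LeftLE σ' ρ') :
    IntervalLE (leftInterval σ ρ) (leftInterval σ' ρ') ↔ RightLE σ σ' := by
  constructor
  · rintro ⟨a, b, c, d, hab, e1, hcd, e2, hac⟩
    rwa [leftInterval_injective h hab e1, leftInterval_injective h' hcd e2]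
  · exact fun hr => ⟨σ, ρ, σ', ρ', h, rfl, h', rfl, hr⟩

/-- `longest` is an arbitrary choice among elements of maximal length; an element containing all
inversion sets leaves only one candidate. -/
theorem longest_eq {n : ℕ} {A : Set (Perm (Fin n))} (hA : A.Nonempty) {w : Perm (Fin n)}
    (hw : w ∈ A) (h : ∀ u ∈ A, inversions u ⊆ inversions w) : longest A hA = w := by
  have hs := (exists_longest A hA).choose_spec
  refine inversions_injective (Finset.eq_of_subset_of_card_le (h _ hs.1) ?_)
  rw [← len_eq_card, ← len_eq_card]
  exact hs.2 w hw

/-! ### Descent-preserving isomorphisms are right translations -/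

/-- Only indices adjacent to `i` need care: there the shared letter moves past a letter already on
the correct side. This recovers the label of a cover from the descent sets of its two ends. -/
theorem eq_of_new_descent {n : ℕ} {γ : Perm (Fin n)} {i j : Fin (n - 1)} (hi' : i ∉ leftDescents γ)
    (hj : j ∉ leftDescents γ) (hj' : j ∈ leftDescents (simple i * γ)) : j = i := by
  by_contra hne
  rw [not_mem_leftDescents] at hi' hj
  rw [mem_leftDescents, mul_inv_rev, simple_inv, Perm.mul_apply, Perm.mul_apply, simple_eq_swap,
    swap_apply_def, swap_apply_def] at hj'
  have hne' : (j : ℕ) ≠ i := fun h => hne (Fin.ext h)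
  have e1 : lo j ≠ lo i := by simp [lo, hne']
  have e2 : hi j ≠ hi i := by simp [hi, hne']
  rw [if_neg e1, if_neg e2] at hj'
  split_ifs at hj' with h1 h2 h2
  · rw [h1, h2] at hj
    exact hi'.asymm hj
  · rw [h1] at hj
    exact (hj.trans hi').asymm hj'
  · rw [h2] at hj
    exact (hi'.trans hj).asymm hj'
  · exact hj.asymm hj'

/-- Induction along a saturated chain from `σ`: if `f` sends the cover `γ`, `simple i * γ` to a
cover with the same label, the factor on the right stays constant. -/
theorem apply_eq_mul {n : ℕ} {σ ρ σ' ρ' : Perm (Fin n)} (hσρ : LeftLE σ ρ)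
    (f : leftInterval σ ρ ≃ leftInterval σ' ρ')
    (hf : ∀ γ δ : leftInterval σ ρ,
      LeftLE (γ : Perm (Fin n)) δ ↔ LeftLE (f γ : Perm (Fin n)) (f δ))
    (hd : ∀ γ : leftInterval σ ρ,
      leftDescents (γ : Perm (Fin n)) = leftDescents (f γ : Perm (Fin n)))
    (γ : leftInterval σ ρ) :
    (f γ : Perm (Fin n)) = γ * (σ⁻¹ * f ⟨σ, LeftLE.refl _, hσρ⟩) := by
  obtain ⟨γ, h1, h2⟩ := γ
  change LeftLE σ γ at h1
  induction h1 with
  | refl => simp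
  | @tail γ _ hγ hst ih =>
    have hst' := hst
    obtain ⟨i, hi', rfl⟩ := hst
    have hle : LeftLE γ (simple i * γ) := Relation.ReflTransGen.single hst'
    have hγρ : LeftLE γ ρ := hle.trans h2
    specialize ih hγρ
    set g : leftInterval σ ρ := ⟨γ, hγ, hγρ⟩ with hg
    set g' : leftInterval σ ρ := ⟨simple i * γ, LeftLE.trans hγ hle, h2⟩ with hg'
    have hgg : g ≠ g' := by
      intro h
      have := card_inversions_simple_mul i γ (not_mem_leftDescents.1 hi')
      rw [← show γ = simple i * γ from congrArg Subtype.val h] at this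
      omega
    have hfle : LeftLE (f g : Perm (Fin n)) (f g') := (hf g g').1 hle
    rcases Relation.ReflTransGen.cases_head hfle with h | ⟨_, ⟨j, hj, rfl⟩, hc⟩
    · exact absurd (f.injective (Subtype.ext h)) hgg
    · have hstep : LeftLE (f g : Perm (Fin n)) (simple j * f g) :=
        Relation.ReflTransGen.single ⟨j, hj, rfl⟩
      -- The first step above `f g` towards `f g'` is pulled back. Its preimage lies between `g` and
      -- `g'` and differs from `g`; as `g'` has one inversion more than `g`, it is `g'`.
      obtain ⟨d, hd'⟩ := f.surjective
        ⟨simple j * f g, (f g).2.1.trans hstep, LeftLE.trans hc (f g').2.2⟩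
      have hgd : LeftLE (g : Perm (Fin n)) d := (hf g d).2 (by rw [hd']; exact hstep)
      have hdg' : LeftLE (d : Perm (Fin n)) g' := (hf d g').2 (by rw [hd']; exact hc)
      have hdne : (d : Perm (Fin n)) ≠ γ := by
        intro h
        have hdg : d = g := Subtype.ext h
        rw [hdg] at hd'
        have := card_inversions_simple_mul j _ (not_mem_leftDescents.1 hj)
        rw [← show (f g : Perm (Fin n)) = simple j * f g from congrArg Subtype.val hd'] at this
        omega
      have hdeq : d = g' := by
        have s1 := leftLE_iff.1 hgd
        have s2 := leftLE_iff.1 hdg'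
        have c1 := card_inversions_simple_mul i γ (not_mem_leftDescents.1 hi')
        have hlt : (inversions γ).card < (inversions (d : Perm (Fin n))).card :=
          Finset.card_lt_card (Finset.ssubset_iff_subset_ne.2
            ⟨s1, fun h => hdne (inversions_injective h).symm⟩)
        exact Subtype.ext (inversions_injective
          (Finset.eq_of_subset_of_card_le s2 (c1.trans_le hlt)))
      rw [hdeq] at hd'
      have hfg' : (f g' : Perm (Fin n)) = simple j * f g := congrArg Subtype.val hd'
      have hij : j = i := by
        refine eq_of_new_descent hi' (by rwa [← hd g] at hj) ?_
        change j ∈ leftDescents (g' : Perm (Fin n))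
        rw [hd g', hfg', mem_leftDescents]
        rw [not_mem_leftDescents] at hj
        simpa [simple_eq_swap, mul_inv_rev, swap_inv] using hj
      change (f g' : Perm (Fin n)) = _
      rw [hfg', hij, ih, mul_assoc]

/-! ### Numberings of boxes -/

theorem numberBy_lt {n : ℕ} {L : Type*} [LinearOrder L] (key : ℕ × ℕ ↪ L) {D : Finset (ℕ × ℕ)}
    (hD : D.card = n) (a b : D) :
    numberBy key D hD a < numberBy key D hD b ↔ key a < key b := by
  exact OrderIso.lt_iff_lt ((D.map key).orderIsoOfFin (by simpa using hD)).symm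

theorem filling_eq_of_lt_iff {n : ℕ} {X : Type*} {f g : X ≃ Fin n}
    (h : ∀ a b, f a < f b ↔ g a < g b) : f = g := by
  have hle (a b) : f a ≤ f b ↔ g a ≤ g b := by rw [← not_lt, ← not_lt, h]
  let e : Fin n ≃o Fin n := ⟨f.symm.trans g, by intro a b; simp [← hle]⟩
  have he : e = OrderIso.refl _ := Subsingleton.elim _ _
  ext x
  have := congrArg (fun e : Fin n ≃o Fin n => (e (f x) : ℕ)) he
  simpa [e] using this.symm

/-! ### Boxes of the composition diagram and their numberings -/

variable {n : ℕ} {α : Composition n}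

theorem mem_compDiagram {b : ℕ × ℕ} :
    b ∈ compDiagram α ↔
      ∃ i : Fin α.length, b.2 = i + 1 ∧ 1 ≤ b.1 ∧ b.1 ≤ α.blocksFun i := by
  simp only [compDiagram, Finset.mem_map, Finset.mem_univ, true_and, Sigma.exists]
  constructor
  · rintro ⟨i, j, rfl⟩
    exact ⟨i, rfl, Nat.le_add_left 1 _, j.2⟩
  · rintro ⟨i, h1, h2, h3⟩
    exact ⟨i, ⟨b.1 - 1, by omega⟩, Prod.ext (Nat.sub_add_cancel h2) h1.symm⟩

theorem one_le_col (b : compDiagram α) : 1 ≤ b.1.1 := by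
  obtain ⟨i, -, h, -⟩ := mem_compDiagram.1 b.2
  exact h

theorem box_ext {a b : compDiagram α} (h1 : a.1.1 = b.1.1) (h2 : a.1.2 = b.1.2) : a = b :=
  Subtype.ext (Prod.ext h1 h2)

/-- The order on boxes for which the immaculate tableaux are the order-preserving fillings. -/
def BoxLE (a b : compDiagram α) : Prop :=
  (a.1.1 = 1 ∧ a.1.2 ≤ b.1.2) ∨ (a.1.2 = b.1.2 ∧ a.1.1 ≤ b.1.1)

theorem exists_box (b : compDiagram α) {k : ℕ} (h1 : 1 ≤ k) (h2 : k ≤ b.1.1) :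
    ∃ c : compDiagram α, c.1 = (k, b.1.2) := by
  obtain ⟨i, h3, -, h4⟩ := mem_compDiagram.1 b.2
  exact ⟨⟨(k, b.1.2), mem_compDiagram.2 ⟨i, h3, h1, h2.trans h4⟩⟩, rfl⟩

/-- A first-column box is compared with a box of a higher row through the first box of that row. -/
theorem isImmaculate_iff {T : compDiagram α ≃ Fin n} :
    IsImmaculate T ↔ ∀ a b, BoxLE a b → T a ≤ T b := by
  constructor
  · rintro ⟨hr, hc⟩ a b hab
    have key {a b : compDiagram α} (h : a.1.2 = b.1.2) (h' : a.1.1 ≤ b.1.1) : T a ≤ T b := by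
      rcases h'.lt_or_eq with h' | h'
      · exact (hr _ _ h h').le
      · rw [box_ext h' h]
    rcases hab with ⟨h1, h2⟩ | ⟨h1, h2⟩
    · rcases h2.lt_or_eq with h2 | h2
      · obtain ⟨c, hc'⟩ := exists_box b le_rfl (one_le_col b)
        exact (hc a c h1 (by rw [hc']) (by rw [hc']; exact h2)).le.trans
          (key (by rw [hc']) (by rw [hc']; exact one_le_col b))
      · exact key h2 (h1.trans_le (one_le_col b))
    · exact key h1 h2
  · intro h
    constructor
    · intro b c h1 h2
      refine lt_of_le_of_ne (h _ _ (Or.inr ⟨h1, h2.le⟩)) fun he => ?_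
      rw [T.injective he] at h2
      exact lt_irrefl _ h2
    · intro b c h1 h2 h3
      refine lt_of_le_of_ne (h _ _ (Or.inl ⟨h1, h3.le⟩)) fun he => ?_
      rw [T.injective he] at h3
      exact lt_irrefl _ h3

theorem IsImmaculate.lt {T : compDiagram α ≃ Fin n} (hT : IsImmaculate T) {a b : compDiagram α}
    (h : BoxLE a b) (hne : a ≠ b) : T a < T b :=
  lt_of_le_of_ne (isImmaculate_iff.1 hT a b h) fun he => hne (T.injective he)

theorem sourceSIT_lt (a b : compDiagram α) :
    sourceSIT α a < sourceSIT α b ↔ a.1.2 < b.1.2 ∨ a.1.2 = b.1.2 ∧ a.1.1 < b.1.1 := by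
  rw [sourceSIT, numberBy_lt]
  exact Prod.Lex.lt_iff

theorem sinkSIT_lt (a b : compDiagram α) :
    sinkSIT α a < sinkSIT α b ↔
      (a.1.1 = 1 ∧ (b.1.1 = 1 → a.1.2 < b.1.2)) ∨
        (a.1.1 ≠ 1 ∧ b.1.1 ≠ 1 ∧ (b.1.2 < a.1.2 ∨ a.1.2 = b.1.2 ∧ a.1.1 < b.1.1)) := by
  have e (x : ℕ × ℕ) : keySink x = if x.1 = 1 then toLex (Sum.inl x.2)
    else toLex (Sum.inr (toLex (OrderDual.toDual x.2, x.1))) := rfl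
  rw [sinkSIT, numberBy_lt, e, e]
  by_cases h1 : a.1.1 = 1 <;> by_cases h2 : b.1.1 = 1 <;>
    simp [h1, h2, Prod.Lex.toLex_lt_toLex]

/-- The numbering of the boxes in which reading words are read. -/
noncomputable def readingNumber (α : Composition n) : compDiagram α ≃ Fin n :=
  numberBy keyRLBT (compDiagram α) (card_compDiagram α)

theorem readingNumber_lt (a b : compDiagram α) :
    readingNumber α a < readingNumber α b ↔
      a.1.2 < b.1.2 ∨ a.1.2 = b.1.2 ∧ b.1.1 < a.1.1 := by
  rw [readingNumber, numberBy_lt]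
  exact Prod.Lex.lt_iff

/-- The numbering of the boxes in which the modified reading words are read. -/
noncomputable def reading'Number (α : Composition n) : compDiagram α ≃ Fin n :=
  numberBy keyRLBTBT (compDiagram α) (card_compDiagram α)

theorem reading'Number_lt (a b : compDiagram α) :
    reading'Number α a < reading'Number α b ↔
      (b.1.1 = 1 ∧ (a.1.1 = 1 → a.1.2 < b.1.2)) ∨
        (a.1.1 ≠ 1 ∧ b.1.1 ≠ 1 ∧ (a.1.2 < b.1.2 ∨ a.1.2 = b.1.2 ∧ b.1.1 < a.1.1)) := by
  have e (x : ℕ × ℕ) : keyRLBTBT x = if x.1 = 1 then toLex (Sum.inr x.2)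
    else toLex (Sum.inl (toLex (x.2, OrderDual.toDual x.1))) := rfl
  rw [reading'Number, numberBy_lt, e, e]
  by_cases h1 : a.1.1 = 1 <;> by_cases h2 : b.1.1 = 1 <;>
    simp [h1, h2, Prod.Lex.toLex_lt_toLex]

/-- The numberings of the boxes that correspond to the standard tableaux on the reflected
immaculate diagram. -/
def IsAdmissible (L : compDiagram α ≃ Fin n) : Prop :=
  ∀ a b : compDiagram α, a.1.2 ≤ b.1.2 →
    (b.1.1 = 1 ∨ a.1.1 ≠ 1 ∧ (a.1.2 < b.1.2 ∨ b.1.1 ≤ a.1.1)) → L a ≤ L b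

theorem IsAdmissible.lt {L : compDiagram α ≃ Fin n} (hL : IsAdmissible L) {a b : compDiagram α}
    (h : a.1.2 ≤ b.1.2) (h' : b.1.1 = 1 ∨ a.1.1 ≠ 1 ∧ (a.1.2 < b.1.2 ∨ b.1.1 ≤ a.1.1))
    (hne : a ≠ b) : L a < L b :=
  lt_of_le_of_ne (hL a b h h') fun he => hne (L.injective he)

theorem isImmaculate_sourceSIT : IsImmaculate (sourceSIT α) := by
  constructor
  · intro b c h1 h2
    exact (sourceSIT_lt b c).2 (Or.inr ⟨h1, h2⟩)
  · intro b c _ _ h2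
    exact (sourceSIT_lt b c).2 (Or.inl h2)

theorem isImmaculate_sinkSIT : IsImmaculate (sinkSIT α) := by
  constructor
  · intro b c h1 h2
    have := one_le_col b
    rw [sinkSIT_lt]
    omega
  · intro b c h1 h2 h3
    rw [sinkSIT_lt]
    omega

theorem ne_of_pos_ne {a b : compDiagram α} (h : a.1.1 ≠ b.1.1 ∨ a.1.2 ≠ b.1.2) : a ≠ b := by
  rintro rfl
  simp at h

theorem isAdmissible_of_lt {L : compDiagram α ≃ Fin n}
    (h : ∀ a b : compDiagram α, a.1.2 ≤ b.1.2 → (a.1.2 < b.1.2 ∨ a.1.1 ≠ b.1.1) →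
      (b.1.1 = 1 ∨ a.1.1 ≠ 1 ∧ (a.1.2 < b.1.2 ∨ b.1.1 ≤ a.1.1)) → L a < L b) :
    IsAdmissible L := by
  intro a b h1 h2
  by_cases hab : a = b
  · rw [hab]
  · refine (h a b h1 ?_ h2).le
    by_contra hc
    push Not at hc
    exact hab (box_ext hc.2 (h1.antisymm hc.1))

theorem isAdmissible_readingNumber : IsAdmissible (readingNumber α) := by
  refine isAdmissible_of_lt fun a b h1 h2 h3 => ?_
  have := one_le_col a
  rw [readingNumber_lt]
  omega

theorem isAdmissible_reading'Number : IsAdmissible (reading'Number α) := by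
  refine isAdmissible_of_lt fun a b h1 h2 h3 => ?_
  have := one_le_col a
  rw [reading'Number_lt]
  omega

/-- Two admissible numberings differ only on pairs formed by a box of the first column and a box
outside it, in a higher row. -/
theorem IsAdmissible.lt_iff {L L' : compDiagram α ≃ Fin n} (hL : IsAdmissible L)
    (hL' : IsAdmissible L') {a b : compDiagram α}
    (h1 : ¬(a.1.1 = 1 ∧ b.1.1 ≠ 1 ∧ a.1.2 < b.1.2))
    (h2 : ¬(b.1.1 = 1 ∧ a.1.1 ≠ 1 ∧ b.1.2 < a.1.2)) : L a < L b ↔ L' a < L' b := by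
  have ha := one_le_col a
  have hb := one_le_col b
  by_cases hab : a = b
  · simp [hab]
  have hne : a.1.1 ≠ b.1.1 ∨ a.1.2 ≠ b.1.2 := by
    by_contra hc
    push Not at hc
    exact hab (box_ext hc.1 hc.2)
  by_cases h : a.1.2 ≤ b.1.2 ∧ (b.1.1 = 1 ∨ a.1.1 ≠ 1 ∧ (a.1.2 < b.1.2 ∨ b.1.1 ≤ a.1.1))
  · simp [hL.lt h.1 h.2 hab, hL'.lt h.1 h.2 hab]
  · have h' : b.1.2 ≤ a.1.2 ∧ (a.1.1 = 1 ∨ b.1.1 ≠ 1 ∧ (b.1.2 < a.1.2 ∨ a.1.1 ≤ b.1.1)) := by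
      omega
    simp [(hL.lt h'.1 h'.2 (Ne.symm hab)).asymm, (hL'.lt h'.1 h'.2 (Ne.symm hab)).asymm]

/-! ### The interval attached to a numbering of the boxes -/

theorem mem_inversions_symm_trans {X : Type*} (L U : X ≃ Fin n) (a b : X) :
    (L a, L b) ∈ inversions (L.symm.trans U) ↔ L a < L b ∧ U b < U a := by
  simp [mem_inversions]

/-- In the word `L.symm.trans U` the positions are the `L`-numbers and the letters the `U`-entries,
so weak order becomes a condition on pairs of boxes. -/
theorem inversions_subset_iff {X : Type*} (L U V : X ≃ Fin n) :
    inversions (L.symm.trans U) ⊆ inversions (L.symm.trans V) ↔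
      ∀ a b, L a < L b → U b < U a → V b < V a := by
  constructor
  · intro h a b h1 h2
    exact ((mem_inversions_symm_trans L V a b).1
      (h ((mem_inversions_symm_trans L U a b).2 ⟨h1, h2⟩))).2
  · rintro h ⟨p, q⟩ hpq
    obtain ⟨a, rfl⟩ := L.surjective p
    obtain ⟨b, rfl⟩ := L.surjective q
    rw [mem_inversions_symm_trans] at hpq ⊢
    exact ⟨hpq.1, h a b hpq.1 hpq.2⟩

/-- If neither the entries nor the reverse reading order is forced on a pair, it is a non-inversion
of the source word and an inversion of the sink word. -/
theorem boxLE_or {L : compDiagram α ≃ Fin n} (hL : IsAdmissible L) (a b : compDiagram α)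
    (hab : L a < L b) : BoxLE a b ∨ BoxLE b a ∨ (sourceSIT α a < sourceSIT α b ∧
      sinkSIT α b < sinkSIT α a) := by
  have ha := one_le_col a
  have hb := one_le_col b
  by_cases h : b.1.2 ≤ a.1.2 ∧ (a.1.1 = 1 ∨ b.1.1 ≠ 1 ∧ (b.1.2 < a.1.2 ∨ a.1.1 ≤ b.1.1))
  · exact absurd hab (not_lt.2 (hL b a h.1 h.2))
  · rw [sourceSIT_lt, sinkSIT_lt, BoxLE, BoxLE]
    omega

/-- The immaculate tableaux, read in the order given by `L`. -/
def words (L : compDiagram α ≃ Fin n) : Set (Perm (Fin n)) :=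
  {γ | IsImmaculate (L.trans γ)}

theorem readingWords_eq : readingWords α = words (readingNumber α) := by
  ext γ
  constructor
  · rintro ⟨T, hT, rfl⟩
    change IsImmaculate _
    convert hT
    ext x
    simp [readBy, readingNumber]
  · intro h
    refine ⟨_, h, ?_⟩
    ext x
    simp [readBy, readingNumber]

/-- Pairs comparable for `BoxLE` have one order in all immaculate tableaux; on the others, by
`boxLE_or`, the source and sink words impose no restriction. Conversely, on a comparable pair source
and sink agree and so fix the order in between. -/
theorem words_eq_leftInterval {L : compDiagram α ≃ Fin n} (hL : IsAdmissible L) :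
    words L = leftInterval (L.symm.trans (sourceSIT α)) (L.symm.trans (sinkSIT α)) := by
  ext γ
  have hγ : γ = L.symm.trans (L.trans γ) := by ext x; simp
  set U := L.trans γ with hU
  have hmem : γ ∈ words L ↔ IsImmaculate U := Iff.rfl
  rw [hmem, hγ]
  change _ ↔ LeftLE _ _ ∧ LeftLE _ _
  rw [leftLE_iff, leftLE_iff, inversions_subset_iff, inversions_subset_iff]
  constructor
  · intro h
    constructor
    · intro a b h1 h2
      have hne : a ≠ b := fun h => by simp [h] at h1
      rcases boxLE_or hL a b h1 with h3 | h3 | h3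
      · exact absurd h2 (isImmaculate_sourceSIT.lt h3 hne).asymm
      · exact h.lt h3 hne.symm
      · exact absurd h2 h3.1.asymm
    · intro a b h1 h2
      have hne : a ≠ b := fun h => by simp [h] at h1
      rcases boxLE_or hL a b h1 with h3 | h3 | h3
      · exact absurd h2 (h.lt h3 hne).asymm
      · exact isImmaculate_sinkSIT.lt h3 hne.symm
      · exact h3.2
  · rintro ⟨h1, h2⟩
    rw [isImmaculate_iff]
    intro a b hab
    by_cases hne : a = b
    · rw [hne]
    rcases lt_or_gt_of_ne (fun h => hne (L.injective h)) with h | h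
    · by_contra hc
      exact (h2 a b h (not_le.1 hc)).asymm (isImmaculate_sinkSIT.lt hab hne)
    · exact (h1 b a h (isImmaculate_sourceSIT.lt hab hne)).le

theorem source_leftLE_sink {L : compDiagram α ≃ Fin n} (hL : IsAdmissible L) :
    LeftLE (L.symm.trans (sourceSIT α)) (L.symm.trans (sinkSIT α)) := by
  have h : L.symm.trans (sourceSIT α) ∈ words L := by
    change IsImmaculate _
    convert isImmaculate_sourceSIT (α := α)
    ext x
    simp
  rw [words_eq_leftInterval hL] at h
  exact h.2

theorem isInterval_words {L : compDiagram α ≃ Fin n} (hL : IsAdmissible L) :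
    IsInterval (words L) :=
  ⟨_, _, source_leftLE_sink hL, words_eq_leftInterval hL⟩

/-! ### The equivalence class -/

theorem mem_leftDescents_symm_trans {X : Type*} (L U : X ≃ Fin n) (i : Fin (n - 1)) :
    i ∈ leftDescents (L.symm.trans U) ↔ L (U.symm (hi i)) < L (U.symm (lo i)) := by
  rw [mem_leftDescents]
  rfl

/-- The pairs on which `L` and `L'` may disagree are comparable for `BoxLE`, so `U` and `V` order
them alike. -/
theorem leftLE_transfer {L L' : compDiagram α ≃ Fin n} (hL : IsAdmissible L)
    (hL' : IsAdmissible L') {U V : compDiagram α ≃ Fin n} (hU : IsImmaculate U)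
    (hV : IsImmaculate V) (h : LeftLE (L.symm.trans U) (L.symm.trans V)) :
    LeftLE (L'.symm.trans U) (L'.symm.trans V) := by
  rw [leftLE_iff, inversions_subset_iff] at h ⊢
  intro a b h1 h2
  have ha := one_le_col a
  have hb := one_le_col b
  have hne : a ≠ b := fun h => by simp [h] at h1
  by_cases h3 : BoxLE a b
  · exact absurd h2 (hU.lt h3 hne).asymm
  by_cases h4 : BoxLE b a
  · exact hV.lt h4 hne.symm
  refine h a b ((hL.lt_iff hL' ?_ ?_).2 h1) h2
  · rw [BoxLE] at h3
    omega
  · rw [BoxLE] at h4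
    omega

theorem leftDescents_eq {L L' : compDiagram α ≃ Fin n} (hL : IsAdmissible L)
    (hL' : IsAdmissible L') {U : compDiagram α ≃ Fin n} (hU : IsImmaculate U) :
    leftDescents (L.symm.trans U) = leftDescents (L'.symm.trans U) := by
  ext i
  rw [mem_leftDescents_symm_trans, mem_leftDescents_symm_trans]
  obtain ⟨a, ha⟩ := U.surjective (lo i)
  obtain ⟨b, hb⟩ := U.surjective (hi i)
  -- The first box of the row of `b` has an entry strictly between, so a pair that `L` and `L'` may
  -- order differently never carries consecutive entries.
  have key {a b : compDiagram α} (h : a.1.1 = 1 ∧ b.1.1 ≠ 1 ∧ a.1.2 < b.1.2) :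
      ∃ c, U a < U c ∧ U c < U b := by
    obtain ⟨c, hc⟩ := exists_box b le_rfl (one_le_col b)
    have h1 : c.1.1 = 1 := by rw [hc]
    have h2 : c.1.2 = b.1.2 := by rw [hc]
    exact ⟨c, hU.lt (Or.inl ⟨h.1, by omega⟩) (ne_of_pos_ne (by omega)),
      hU.lt (Or.inl ⟨h1, h2.le⟩) (ne_of_pos_ne (by omega))⟩
  rw [← ha, ← hb, U.symm_apply_apply, U.symm_apply_apply]
  have hlo : ((U a : Fin n) : ℕ) = i := by rw [ha]; rfl
  have hhi : ((U b : Fin n) : ℕ) = i + 1 := by rw [hb]; rfl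
  refine hL.lt_iff hL' (fun h => ?_) (fun h => ?_) <;>
  · obtain ⟨c, h1, h2⟩ := key h
    rw [Fin.lt_def] at h1 h2
    omega

theorem descentEquiv_words {L L' : compDiagram α ≃ Fin n} (hL : IsAdmissible L)
    (hL' : IsAdmissible L') : DescentEquiv (words L) (words L') := by
  let f : words L ≃ words L' :=
    { toFun := fun γ => ⟨L'.symm.trans (L.trans γ.1), by
        have := γ.2
        change IsImmaculate _ at this
        change IsImmaculate _
        convert this using 1
        ext; simp⟩
      invFun := fun γ => ⟨L.symm.trans (L'.trans γ.1), by
        have := γ.2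
        change IsImmaculate _ at this
        change IsImmaculate _
        convert this using 1
        ext; simp⟩
      left_inv := fun γ => by ext; simp
      right_inv := fun γ => by ext; simp }
  have e (γ : words L) : (γ : Perm (Fin n)) = L.symm.trans (L.trans γ.1) := by ext; simp
  refine ⟨f, fun γ δ => ?_, fun γ => ?_⟩
  · rw [e γ, e δ]
    exact ⟨leftLE_transfer hL hL' γ.2 δ.2, leftLE_transfer hL' hL γ.2 δ.2⟩
  · rw [e γ]
    exact leftDescents_eq hL hL' γ.2

theorem adjacent_of_leftDescents {X : Type*} {L L' U : X ≃ Fin n}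
    (h : leftDescents (L.symm.trans U) = leftDescents (L'.symm.trans U)) {a b : X}
    (hab : (U b : ℕ) = U a + 1) : L b < L a ↔ L' b < L' a := by
  obtain ⟨i, h1, h2⟩ := exists_lo_hi hab
  have := Set.ext_iff.1 h i
  rwa [mem_leftDescents_symm_trans, mem_leftDescents_symm_trans, ← h1, ← h2, U.symm_apply_apply,
    U.symm_apply_apply] at this

/-- Descents compare `L` only on boxes with consecutive `U`-entries; along a run of entries on which
`L'` is increasing, these comparisons chain. -/
theorem lt_of_leftDescents {X : Type*} {L L' U : X ≃ Fin n}
    (h : leftDescents (L.symm.trans U) = leftDescents (L'.symm.trans U)) {a b : X} (hab : U a < U b)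
    (hc : ∀ c d, U a ≤ U c → U c < U d → U d ≤ U b → L' c < L' d) : L a < L b := by
  have := rel_of_adjacent (r := (· < ·)) (fun h1 h2 => h1.trans h2) (fun x => L (U.symm x)) hab
    (fun x y hx hxy hy => by
      obtain ⟨c, rfl⟩ := U.surjective x
      obtain ⟨d, rfl⟩ := U.surjective y
      have hcd : U c < U d := by rw [Fin.lt_def]; omega
      simp only [U.symm_apply_apply]
      have hne : L c ≠ L d := fun h => by rw [L.injective h] at hcd; exact lt_irrefl _ hcd
      refine lt_of_le_of_ne (not_lt.1 fun hlt => ?_) hne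
      exact ((adjacent_of_leftDescents h hxy).1 hlt).asymm (hc c d hx hcd hy))
  simpa using this

theorem gt_of_leftDescents {X : Type*} {L L' U : X ≃ Fin n}
    (h : leftDescents (L.symm.trans U) = leftDescents (L'.symm.trans U)) {a b : X} (hab : U a < U b)
    (hc : ∀ c d, U a ≤ U c → U c < U d → U d ≤ U b → L' d < L' c) : L b < L a := by
  have := rel_of_adjacent (r := (· > ·)) (fun h1 h2 => gt_trans h1 h2) (fun x => L (U.symm x)) hab
    (fun x y hx hxy hy => by
      obtain ⟨c, rfl⟩ := U.surjective x
      obtain ⟨d, rfl⟩ := U.surjective y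
      have hcd : U c < U d := by rw [Fin.lt_def]; omega
      simp only [U.symm_apply_apply]
      exact (adjacent_of_leftDescents h hxy).2 (hc c d hx hcd hy))
  simpa using this

/-- Admissibility is detected by the descents of the source and the sink. -/
theorem isAdmissible_of_leftDescents {L : compDiagram α ≃ Fin n}
    (h1 : leftDescents (L.symm.trans (sourceSIT α)) =
      leftDescents ((readingNumber α).symm.trans (sourceSIT α)))
    (h2 : leftDescents (L.symm.trans (sinkSIT α)) =
      leftDescents ((readingNumber α).symm.trans (sinkSIT α))) : IsAdmissible L := by
  -- The source fills each row with a run of entries along which `readingNumber` decreases.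
  have hrow {a b : compDiagram α} (h : a.1.2 = b.1.2) (h' : b.1.1 < a.1.1) : L a < L b := by
    refine gt_of_leftDescents h1 ((sourceSIT_lt b a).2 (Or.inr ⟨h.symm, h'⟩)) ?_
    intro c d hc hcd hd
    rw [← not_lt, sourceSIT_lt] at hc hd
    rw [sourceSIT_lt] at hcd
    rw [readingNumber_lt]
    omega
  -- The sink starts with the first column, where `readingNumber` increases, and then runs through
  -- the other boxes with `readingNumber` decreasing.
  have hcol {a b : compDiagram α} (ha : a.1.1 = 1) (hb : b.1.1 = 1) (h : a.1.2 < b.1.2) :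
      L a < L b := by
    refine lt_of_leftDescents h2 ((sinkSIT_lt a b).2 (Or.inl ⟨ha, fun _ => h⟩)) ?_
    intro c d hc hcd hd
    rw [← not_lt, sinkSIT_lt] at hc hd
    rw [sinkSIT_lt] at hcd
    rw [readingNumber_lt]
    omega
  have hout {a b : compDiagram α} (ha : a.1.1 ≠ 1) (hb : b.1.1 ≠ 1) (h : a.1.2 < b.1.2) :
      L a < L b := by
    refine gt_of_leftDescents h2 ((sinkSIT_lt b a).2 (Or.inr ⟨hb, ha, Or.inl h⟩)) ?_
    intro c d hc hcd hd
    rw [← not_lt, sinkSIT_lt] at hc hd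
    rw [sinkSIT_lt] at hcd
    rw [readingNumber_lt]
    omega
  refine isAdmissible_of_lt fun a b h3 h4 h5 => ?_
  have ha := one_le_col a
  rcases h3.lt_or_eq with h3 | h3
  · by_cases ha' : a.1.1 = 1
    · exact hcol ha' (by omega) h3
    · by_cases hb : b.1.1 = 1
      · obtain ⟨c, hc⟩ := exists_box a le_rfl ha
        have hc1 : c.1.1 = 1 := by rw [hc]
        have hc2 : c.1.2 = a.1.2 := by rw [hc]
        exact (hrow hc2.symm (by omega)).trans (hcol hc1 hb (by omega))
      · exact hout ha' hb h3
  · exact hrow h3 (by omega)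

theorem immaculateClass_eq :
    immaculateClass α = {J | ∃ L : compDiagram α ≃ Fin n, IsAdmissible L ∧ J = words L} := by
  ext J
  constructor
  · rintro ⟨⟨σ', ρ', hσρ', rfl⟩, hd⟩
    rw [readingWords_eq, words_eq_leftInterval isAdmissible_readingNumber] at hd
    obtain ⟨f, hf, hfd⟩ := hd
    have hle := source_leftLE_sink (isAdmissible_readingNumber (α := α))
    have happ := apply_eq_mul hle f hf hfd
    set w := ((readingNumber α).symm.trans (sourceSIT α) : Perm (Fin n))⁻¹ *
      f ⟨_, LeftLE.refl _, hle⟩ with hw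
    -- Right translation by `w` permutes positions, so it amounts to renumbering the boxes by `w⁻¹`.
    let L : compDiagram α ≃ Fin n := (readingNumber α).trans w⁻¹
    have hfL (U : compDiagram α ≃ Fin n) (hU) :
        (f ⟨(readingNumber α).symm.trans U, hU⟩ : Perm (Fin n)) = L.symm.trans U := by
      rw [happ]
      rfl
    have hL : IsAdmissible L := by
      apply isAdmissible_of_leftDescents
      · rw [← hfL _ ⟨LeftLE.refl _, hle⟩, ← hfd]
      · rw [← hfL _ ⟨hle, LeftLE.refl _⟩, ← hfd]
    refine ⟨L, hL, ?_⟩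
    ext γ
    constructor
    · intro hγ
      obtain ⟨δ, hδ⟩ := f.surjective ⟨γ, hγ⟩
      have hδ' : (δ : Perm (Fin n)) ∈ words (readingNumber α) := by
        rw [words_eq_leftInterval isAdmissible_readingNumber]
        exact δ.2
      change IsImmaculate _ at hδ'
      change IsImmaculate _
      have e : γ = δ * w := by rw [← happ, hδ]
      convert hδ' using 1
      rw [e]
      ext x
      simp [L]
    · intro hγ
      have hγ' : γ * w⁻¹ ∈ words (readingNumber α) := hγ
      rw [words_eq_leftInterval isAdmissible_readingNumber] at hγ'
      have := (f ⟨_, hγ'⟩).2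
      rw [happ] at this
      simpa using this
  · rintro ⟨L, hL, rfl⟩
    refine ⟨isInterval_words hL, ?_⟩
    rw [readingWords_eq]
    exact descentEquiv_words isAdmissible_readingNumber hL

/-! ### Standard tableaux on the reflected immaculate diagram -/

/-- The height in the immaculate diagram of the box that corresponds to `b`. -/
def height (α : Composition n) (b : ℕ × ℕ) : ℕ :=
  if b.1 = 1 then 1 else b.1 + shift α b.2

/-- The sum defining the shift at `a` contains the term of the row of `b` and all terms above it.
Hence the boxes outside the first column occupy disjoint ranges of heights, lower for higher rows.
-/
theorem shift_add_le {a b : compDiagram α} (h : a.1.2 < b.1.2) :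
    b.1.1 + shift α b.1.2 ≤ shift α a.1.2 + 1 := by
  obtain ⟨i, h1, h2, h3⟩ := mem_compDiagram.1 b.2
  have hs : insert i (Finset.univ.filter fun r : Fin α.length => b.1.2 < r.val + 1) ⊆
      Finset.univ.filter fun r : Fin α.length => a.1.2 < r.val + 1 := by
    intro r hr
    simp only [Finset.mem_insert, Finset.mem_filter, Finset.mem_univ, true_and] at hr ⊢
    rcases hr with rfl | hr <;> omega
  have hle := Finset.sum_le_sum_of_subset (f := fun r => α.blocksFun r - 1) hs
  rw [Finset.sum_insert (by simp [h1])] at hle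
  rw [shift, shift]
  omega

/-- The right side is the condition in `IsAdmissible`, which is thus the south-east order on the
diagram. -/
theorem height_le_iff {a b : compDiagram α} (h : a.1.2 ≤ b.1.2) :
    height α b ≤ height α a ↔
      (b.1.1 = 1 ∨ a.1.1 ≠ 1 ∧ (a.1.2 < b.1.2 ∨ b.1.1 ≤ a.1.1)) := by
  have ha := one_le_col a
  have hb := one_le_col b
  unfold height
  rcases h.lt_or_eq with h | h
  · have := shift_add_le h
    split_ifs <;> omega
  · rw [h]
    split_ifs <;> omega

theorem boxLE_iff {a b : compDiagram α} :
    BoxLE a b ↔ a.1.2 ≤ b.1.2 ∧ height α a ≤ height α b := by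
  have ha := one_le_col a
  have hb := one_le_col b
  unfold height BoxLE
  rcases lt_trichotomy a.1.2 b.1.2 with h | h | h
  · have := shift_add_le h
    split_ifs <;> omega
  · rw [h]
    split_ifs <;> omega
  · omega

theorem mem_immaculateDiagram {c : ℕ × ℕ} :
    c ∈ immaculateDiagram α ↔ ∃ b ∈ compDiagram α, (b.2, height α b) = c := by
  simp only [immaculateDiagram, Finset.mem_union, Finset.mem_image, Finset.mem_filter]
  constructor
  · rintro (⟨b, ⟨hb, h1⟩, rfl⟩ | ⟨b, ⟨hb, h1⟩, rfl⟩)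
    · exact ⟨b, hb, by simp [height, h1]⟩
    · exact ⟨b, hb, by simp [height, show b.1 ≠ 1 by omega]⟩
  · rintro ⟨b, hb, rfl⟩
    have := one_le_col ⟨b, hb⟩
    by_cases h1 : b.1 = 1
    · exact Or.inl ⟨b, ⟨hb, h1⟩, by simp [height, h1]⟩
    · exact Or.inr ⟨b, ⟨hb, by simp only at this; omega⟩, by simp [height, h1]⟩

/-- The bijection between the boxes of the composition diagram and those of the reflected
immaculate diagram. -/
noncomputable def boxEquiv (α : Composition n) :
    compDiagram α ≃ reflect (immaculateDiagram α) :=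
  (Equiv.ofBijective (fun b : compDiagram α =>
      (⟨(b.1.2, height α b), mem_immaculateDiagram.2 ⟨b, b.2, rfl⟩⟩ : immaculateDiagram α))
    ⟨fun a b h => by
      have h' := Prod.ext_iff.1 (congrArg Subtype.val h)
      have h1 : a.1.2 = b.1.2 := h'.1
      have h2 : height α a = height α b := h'.2
      have e1 := boxLE_iff.2 ⟨h1.le, h2.le⟩
      have e2 := boxLE_iff.2 ⟨h1.ge, h2.ge⟩
      unfold BoxLE at e1 e2
      have h3 := one_le_col a
      have h4 := one_le_col b
      exact box_ext (by omega) h1,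
    fun ⟨c, hc⟩ => by
      obtain ⟨b, hb, h⟩ := mem_immaculateDiagram.1 hc
      exact ⟨⟨b, hb⟩, Subtype.ext h⟩⟩).trans
  (reflectEquiv (immaculateDiagram α))

theorem boxEquiv_apply (b : compDiagram α) : (boxEquiv α b).1 =
    (b.1.2, (immaculateDiagram α).sup Prod.snd + 1 - height α b) := rfl

theorem height_le_sup (b : compDiagram α) :
    height α b ≤ (immaculateDiagram α).sup Prod.snd :=
  Finset.le_sup (f := Prod.snd) (mem_immaculateDiagram.2 ⟨b.1, b.2, rfl⟩)

theorem standard_iff (T : reflect (immaculateDiagram α) ≃ Fin n) :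
    (∀ b c : reflect (immaculateDiagram α), b.1.1 ≤ c.1.1 → b.1.2 ≤ c.1.2 → T b ≤ T c) ↔
      IsAdmissible ((boxEquiv α).trans T) := by
  have key (a b : compDiagram α) : (boxEquiv α a).1.2 ≤ (boxEquiv α b).1.2 ↔
      height α b ≤ height α a := by
    have := height_le_sup a
    have := height_le_sup b
    rw [boxEquiv_apply, boxEquiv_apply]
    change _ - _ ≤ _ - _ ↔ _
    omega
  constructor
  · intro h a b h1 h2
    exact h _ _ h1 ((key a b).2 ((height_le_iff h1).2 h2))
  · intro h b c h1 h2
    obtain ⟨b, rfl⟩ := (boxEquiv α).surjective b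
    obtain ⟨c, rfl⟩ := (boxEquiv α).surjective c
    have h1' : b.1.2 ≤ c.1.2 := h1
    exact h b c h1' ((height_le_iff h1').1 ((key b c).1 h2))

theorem sigmaL_eq_words (T : reflect (immaculateDiagram α) ≃ Fin n) :
    sigmaL (diagramPoset (reflectFilling T)) = words ((boxEquiv α).trans T) := by
  have hle (a b : compDiagram α) :
      (diagramPoset (reflectFilling T)).le (T (boxEquiv α a)) (T (boxEquiv α b)) ↔ BoxLE a b := by
    have e (a : compDiagram α) :
        ((reflectFilling T).symm (T (boxEquiv α a)) : ℕ × ℕ) =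
          flipBox (reflect (immaculateDiagram α)) (boxEquiv α a) := by
      change (reflectEquiv _ (T.symm (T (boxEquiv α a))) : ℕ × ℕ) = _
      rw [T.symm_apply_apply]
      rfl
    change ((reflectFilling T).symm (T (boxEquiv α a)) : ℕ × ℕ) ≤
      ((reflectFilling T).symm (T (boxEquiv α b)) : ℕ × ℕ) ↔ _
    rw [e, e, boxLE_iff, Prod.le_def, flipBox, flipBox]
    -- These bounds keep the truncated subtractions exact, so the two flips together preserve the
    -- order of heights.
    have ha1 := height_le_sup a
    have hb1 := height_le_sup b
    have ha2 : (boxEquiv α a).1.2 ≤ (reflect (immaculateDiagram α)).sup Prod.snd :=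
      Finset.le_sup (f := Prod.snd) (boxEquiv α a).2
    have hb2 : (boxEquiv α b).1.2 ≤ (reflect (immaculateDiagram α)).sup Prod.snd :=
      Finset.le_sup (f := Prod.snd) (boxEquiv α b).2
    rw [boxEquiv_apply] at ha2 hb2 ⊢
    rw [boxEquiv_apply]
    simp only at ha2 hb2 ⊢
    omega
  ext γ
  change _ ↔ IsImmaculate _
  rw [isImmaculate_iff]
  constructor
  · intro h a b hab
    exact h _ _ ((hle a b).2 hab)
  · intro h i j hij
    obtain ⟨x, rfl⟩ := T.surjective i
    obtain ⟨y, rfl⟩ := T.surjective j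
    obtain ⟨a, rfl⟩ := (boxEquiv α).surjective x
    obtain ⟨b, rfl⟩ := (boxEquiv α).surjective y
    exact h a b ((hle a b).1 hij)

/-- A column of the reflected diagram, read downwards, is a row of `tcd(α)` read from left to right.
The boxes are therefore visited in the order of the source. -/
theorem readBy_keyTBLR (T : reflect (immaculateDiagram α) ≃ Fin n) :
    readBy keyTBLR T = (((boxEquiv α).trans T).symm.trans (sourceSIT α) : Perm (Fin n))⁻¹ := by
  have hn : (reflect (immaculateDiagram α)).card = n := by simpa using Fintype.card_congr T
  have e : (boxEquiv α).trans (numberBy keyTBLR _ hn) = sourceSIT α := by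
    apply filling_eq_of_lt_iff
    intro a b
    rw [sourceSIT_lt, Equiv.trans_apply, Equiv.trans_apply, numberBy_lt]
    have ha := height_le_sup a
    have hb := height_le_sup b
    have hk := boxLE_iff (a := a) (b := b)
    have hk' := boxLE_iff (a := b) (b := a)
    unfold BoxLE at hk hk'
    have h1 := one_le_col a
    have h2 := one_le_col b
    refine Iff.trans (Prod.Lex.lt_iff (x := keyTBLR (boxEquiv α a).1)) ?_
    change a.1.2 < b.1.2 ∨ a.1.2 = b.1.2 ∧ (immaculateDiagram α).sup Prod.snd + 1 - height α b <
      (immaculateDiagram α).sup Prod.snd + 1 - height α a ↔ _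
    omega
  ext x
  change ((T ((numberBy keyTBLR _ hn).symm x) : Fin n) : ℕ) =
    T (boxEquiv α ((sourceSIT α).symm x))
  rw [← e]
  simp

/-- The numbering of the boxes that corresponds to a standard tableau. -/
noncomputable def toNumbering (T : StandardTableau n (reflect (immaculateDiagram α))) :
    compDiagram α ≃ Fin n :=
  (boxEquiv α).trans T.1

theorem isAdmissible_toNumbering (T : StandardTableau n (reflect (immaculateDiagram α))) :
    IsAdmissible (toNumbering T) :=
  (standard_iff T.1).1 T.2

theorem exists_toNumbering {L : compDiagram α ≃ Fin n} (hL : IsAdmissible L) :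
    ∃ T, toNumbering T = L := by
  have h : (boxEquiv α).trans ((boxEquiv α).symm.trans L) = L := by ext; simp
  exact ⟨⟨(boxEquiv α).symm.trans L, (standard_iff _).2 (h.symm ▸ hL)⟩, h⟩

theorem toNumbering_injective : Function.Injective
    (toNumbering : StandardTableau n (reflect (immaculateDiagram α)) → _) := by
  intro T U h
  refine Subtype.ext (Equiv.ext fun x => ?_)
  obtain ⟨a, rfl⟩ := (boxEquiv α).surjective x
  exact Equiv.congr_fun h a

/-! ### The order on the class and the order on tableaux -/

theorem words_injective {L L' : compDiagram α ≃ Fin n} (hL : IsAdmissible L)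
    (hL' : IsAdmissible L') (h : words L = words L') : L = L' := by
  rw [words_eq_leftInterval hL, words_eq_leftInterval hL'] at h
  have := leftInterval_injective (source_leftLE_sink hL) (source_leftLE_sink hL') h
  have h2 : L.symm = L'.symm := by
    ext1 x
    exact (sourceSIT α).injective (Equiv.congr_fun this x)
  exact Equiv.symm_bijective.injective h2

theorem intervalLE_words {L L' : compDiagram α ≃ Fin n} (hL : IsAdmissible L)
    (hL' : IsAdmissible L') : IntervalLE (words L) (words L') ↔
      LeftLE (L.symm.trans (sourceSIT α) : Perm (Fin n))⁻¹
        (L'.symm.trans (sourceSIT α) : Perm (Fin n))⁻¹ := by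
  rw [words_eq_leftInterval hL, words_eq_leftInterval hL',
    intervalLE_iff (source_leftLE_sink hL) (source_leftLE_sink hL'), rightLE_iff]

theorem intervalLE_words' {L L' : compDiagram α ≃ Fin n} (hL : IsAdmissible L)
    (hL' : IsAdmissible L') : IntervalLE (words L) (words L') ↔
      ∀ a b, sourceSIT α a < sourceSIT α b → L b < L a → L' b < L' a := by
  rw [intervalLE_words hL hL', ← inversions_subset_iff, leftLE_iff]
  rfl

theorem tableauLE_iff (T U : StandardTableau n (reflect (immaculateDiagram α))) :
    TableauLE T U ↔ IntervalLE (words (toNumbering T)) (words (toNumbering U)) := by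
  rw [intervalLE_words (isAdmissible_toNumbering T) (isAdmissible_toNumbering U), TableauLE,
    readBy_keyTBLR, readBy_keyTBLR]
  rfl

theorem words_mem_immaculateClass {L : compDiagram α ≃ Fin n} (hL : IsAdmissible L) :
    words L ∈ immaculateClass α := by
  rw [immaculateClass_eq]
  exact ⟨L, hL, rfl⟩

theorem immaculateClass_eq_sigmaL : immaculateClass α =
    {I | ∃ T : StandardTableau n (reflect (immaculateDiagram α)),
      I = sigmaL (diagramPoset (reflectFilling T.1))} := by
  rw [immaculateClass_eq]
  ext J
  constructor
  · rintro ⟨L, hL, rfl⟩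
    obtain ⟨T, rfl⟩ := exists_toNumbering hL
    exact ⟨T, (sigmaL_eq_words T.1).symm⟩
  · rintro ⟨T, rfl⟩
    exact ⟨_, isAdmissible_toNumbering T, sigmaL_eq_words T.1⟩

theorem isPartialOrder_immaculateClass : IsPartialOrder (immaculateClass α)
    (fun I J => IntervalLE (I : Set (Perm (Fin n))) J) where
  refl := by
    rintro ⟨I, hI⟩
    obtain ⟨L, hL, rfl⟩ := immaculateClass_eq.subset hI
    exact (intervalLE_words hL hL).2 (LeftLE.refl _)
  trans := by
    rintro ⟨I, hI⟩ ⟨J, hJ⟩ ⟨K, hK⟩ h1 h2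
    obtain ⟨L, hL, rfl⟩ := immaculateClass_eq.subset hI
    obtain ⟨L', hL', rfl⟩ := immaculateClass_eq.subset hJ
    obtain ⟨L'', hL'', rfl⟩ := immaculateClass_eq.subset hK
    exact (intervalLE_words hL hL'').2
      (((intervalLE_words hL hL').1 h1).trans ((intervalLE_words hL' hL'').1 h2))
  antisymm := by
    rintro ⟨I, hI⟩ ⟨J, hJ⟩ h1 h2
    obtain ⟨L, hL, rfl⟩ := immaculateClass_eq.subset hI
    obtain ⟨L', hL', rfl⟩ := immaculateClass_eq.subset hJ
    have h := ((intervalLE_words hL hL').1 h1).antisymm ((intervalLE_words hL' hL).1 h2)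
    have h' : L.symm = L'.symm := by
      ext1 x
      exact (sourceSIT α).injective (Equiv.congr_fun (inv_injective h) x)
    exact Subtype.ext (congrArg words (Equiv.symm_bijective.injective h'))

/-- The class of a standard tableau. -/
noncomputable def tableauClassEquiv (α : Composition n) :
    StandardTableau n (reflect (immaculateDiagram α)) ≃ immaculateClass α :=
  Equiv.ofBijective
    (fun T => ⟨words (toNumbering T), words_mem_immaculateClass (isAdmissible_toNumbering T)⟩)
    ⟨fun T U h => toNumbering_injective (words_injective (isAdmissible_toNumbering T)
      (isAdmissible_toNumbering U) (congrArg Subtype.val h)), by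
      rintro ⟨I, hI⟩
      obtain ⟨L, hL, rfl⟩ := immaculateClass_eq.subset hI
      obtain ⟨T, rfl⟩ := exists_toNumbering hL
      exact ⟨T, rfl⟩⟩

/-- The isomorphism of posets between the class and the standard tableaux. -/
noncomputable def classRelIso (α : Composition n) :
    (fun I J : immaculateClass α => IntervalLE (I : Set (Perm (Fin n))) J) ≃r
      (TableauLE : StandardTableau n (reflect (immaculateDiagram α)) → _ → Prop) :=
  RelIso.symm ⟨tableauClassEquiv α, fun {T U} => (tableauLE_iff T U).symm⟩

theorem isPartialOrder_tableauLE : IsPartialOrder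
    (StandardTableau n (reflect (immaculateDiagram α))) TableauLE := by
  have := isPartialOrder_immaculateClass (α := α)
  exact (classRelIso α).symm.toRelEmbedding.isPartialOrder

/-! ### The minimum of the class -/

theorem monotone_index (α : Composition n) : Monotone α.index := by
  intro j k hjk
  by_contra hc
  have h1 : (α.index k : ℕ) + 1 ≤ α.index j := not_le.1 hc
  have h2 := α.monotone_sizeUpTo h1
  have h3 := α.sizeUpTo_index_le j
  have h4 := α.lt_sizeUpTo_index_succ k
  rw [Fin.le_def] at hjk
  simp only [Fin.val_succ] at h4
  omega

/-- A numbering of the boxes that is increasing with the rows numbers each row by the corresponding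
block of the composition. -/
theorem index_of_row_monotone {N : compDiagram α ≃ Fin n}
    (hN : ∀ a b, N a < N b → a.1.2 ≤ b.1.2) (b : compDiagram α) :
    (α.index (N b) : ℕ) + 1 = b.1.2 := by
  let S : (Σ i : Fin α.length, Fin (α.blocksFun i)) ≃ compDiagram α :=
    Equiv.ofBijective
      (fun p => ⟨((p.2 : ℕ) + 1, (p.1 : ℕ) + 1),
        mem_compDiagram.2 ⟨p.1, rfl, Nat.le_add_left 1 _, p.2.2⟩⟩)
      ⟨by
        rintro ⟨i, j⟩ ⟨i', j'⟩ h
        simp only [Subtype.mk.injEq, Prod.mk.injEq, add_left_inj] at h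
        obtain ⟨h1, h2⟩ := h
        obtain rfl := Fin.ext h2
        obtain rfl := Fin.ext h1
        rfl,
      by
        rintro ⟨b, hb⟩
        obtain ⟨i, h1, h2, h3⟩ := mem_compDiagram.1 hb
        exact ⟨⟨i, ⟨b.1 - 1, by omega⟩⟩, Subtype.ext (Prod.ext (Nat.sub_add_cancel h2) h1.symm)⟩⟩
  let N0 : compDiagram α ≃ Fin n := S.symm.trans α.blocksFinEquiv
  have h0 (p : Fin n) : (N0.symm p).1.2 = α.index p + 1 := rfl
  let f : Fin n → ℕ := fun p => (N0.symm p).1.2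
  have m1 : Monotone (f ∘ (1 : Perm (Fin n))) := by
    intro p q hpq
    have : (α.index p : ℕ) ≤ α.index q := monotone_index α hpq
    change (N0.symm p).1.2 ≤ (N0.symm q).1.2
    rw [h0, h0]
    omega
  have m2 : Monotone (f ∘ (N.symm.trans N0 : Perm (Fin n))) := by
    intro p q hpq
    obtain ⟨a, rfl⟩ := N.surjective p
    obtain ⟨b, rfl⟩ := N.surjective q
    simp only [f, Function.comp_apply, Equiv.trans_apply, Equiv.symm_apply_apply]
    rcases hpq.lt_or_eq with h | h
    · exact hN a b h
    · rw [N.injective h]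
  -- The row sequences of `N0` and `N` are monotone rearrangements of one another, hence equal.
  have := congrFun (Tuple.unique_monotone m1 m2) (N b)
  simp only [f, Function.comp_apply, Equiv.trans_apply, Equiv.symm_apply_apply, h0,
    Perm.coe_one, id_eq] at this
  rw [this, ← h0, Equiv.symm_apply_apply]

/-- A partial sum equal to `i + 1` is a block boundary separating the zero-based places `i` and `i +
1`. -/
theorem mem_compl_compSet {i : Fin (n - 1)} :
    i ∈ (compSet α)ᶜ ↔ α.index (lo i) = α.index (hi i) := by
  have l1 : α.sizeUpTo (α.index (lo i)) ≤ i := α.sizeUpTo_index_le (lo i)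
  have l2 : (i : ℕ) < α.sizeUpTo (α.index (lo i) + 1) := α.lt_sizeUpTo_index_succ (lo i)
  have h1 : α.sizeUpTo (α.index (hi i)) ≤ i + 1 := α.sizeUpTo_index_le (hi i)
  have h2 : (i : ℕ) + 1 < α.sizeUpTo (α.index (hi i) + 1) := α.lt_sizeUpTo_index_succ (hi i)
  rw [← not_iff_not, Set.mem_compl_iff, not_not]
  constructor
  · rintro ⟨k, hk1, hk2, hk3⟩ he
    rw [← he] at h2
    rcases le_or_gt k (α.index (lo i) : ℕ) with h | h
    · have := α.monotone_sizeUpTo h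
      omega
    · have := α.monotone_sizeUpTo (Nat.succ_le_of_lt h)
      rw [Nat.succ_eq_add_one] at this
      omega
  · intro hne
    have hlt : (α.index (lo i) : ℕ) < α.index (hi i) :=
      lt_of_le_of_ne (monotone_index α (lo_lt_hi i).le) fun h => hne (Fin.ext h)
    have := α.monotone_sizeUpTo (Nat.succ_le_of_lt hlt)
    rw [Nat.succ_eq_add_one] at this
    exact ⟨α.index (hi i), by omega, (α.index (hi i)).2, by omega⟩

theorem index_simple {i : Fin (n - 1)} (h : α.index (lo i) = α.index (hi i)) (p : Fin n) :
    α.index (simple i p) = α.index p := by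
  rw [simple_eq_swap, swap_apply_def]
  split_ifs with h1 h1
  · rw [h1, h]
  · rw [h1, h]
  · rfl

/-- This is the Young subgroup of block-preserving permutations. Conversely, a left descent of such
a permutation exchanges letters of one block, because `index` is monotone; stripping it leaves fewer
inversions. -/
theorem mem_parabolic {σ : Perm (Fin n)} :
    σ ∈ parabolic (compSet α)ᶜ ↔ ∀ p, α.index (σ p) = α.index p := by
  constructor
  · intro h
    induction h using Subgroup.closure_induction with
    | mem _ hx =>
      obtain ⟨i, hi', rfl⟩ := hx
      exact index_simple (mem_compl_compSet.1 hi')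
    | one => exact fun _ => rfl
    | mul x y _ _ hx hy => exact fun p => (hx _).trans (hy p)
    | inv x _ hx =>
      intro p
      rw [← hx (x⁻¹ p)]
      exact congrArg α.index (x.apply_symm_apply p)
  · intro h
    obtain ⟨k, hk⟩ : ∃ k, k = (inversions σ).card := ⟨_, rfl⟩
    induction k using Nat.strong_induction_on generalizing σ with
    | _ k ih =>
      by_cases h1 : σ = 1
      · exact h1 ▸ (parabolic _).one_mem
      · obtain ⟨i, hi'⟩ := exists_descent (inv_ne_one.2 h1)
        have hc := card_inversions_simple_mul' i σ hi'
        have hidx : α.index (lo i) = α.index (hi i) := by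
          apply le_antisymm (monotone_index α (lo_lt_hi i).le)
          have := monotone_index α hi'.le
          rwa [← h (σ⁻¹ (hi i)), ← h (σ⁻¹ (lo i)),
            show σ (σ⁻¹ (hi i)) = hi i from σ.apply_symm_apply _,
            show σ (σ⁻¹ (lo i)) = lo i from σ.apply_symm_apply _] at this
        have hmem := ih (inversions (simple i * σ)).card (by omega)
          (fun p => (index_simple hidx (σ p)).trans (h p)) rfl
        rw [← simple_mul_cancel_left i σ]
        exact (parabolic _).mul_mem
          (Subgroup.subset_closure ⟨i, mem_compl_compSet.2 hidx, rfl⟩) hmem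

/-- Block-preserving permutations invert only pairs inside a block, and the reading order reverses
every row of the source. -/
theorem w0_eq : w0 (compSet α)ᶜ = (readingNumber α).symm.trans (sourceSIT α) := by
  have hs := index_of_row_monotone (N := sourceSIT α) fun a b h => by
    rw [sourceSIT_lt] at h
    omega
  have hr := index_of_row_monotone (N := readingNumber α) fun a b h => by
    rw [readingNumber_lt] at h
    omega
  refine longest_eq _ (mem_parabolic.2 fun p => ?_) ?_
  · obtain ⟨a, rfl⟩ := (readingNumber α).surjective p
    have h1 := hs a
    have h2 := hr a
    rw [Equiv.trans_apply, Equiv.symm_apply_apply]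
    exact Fin.ext (by omega)
  · rintro u hu ⟨p, q⟩ hpq
    have hu' := mem_parabolic.1 hu
    obtain ⟨a, rfl⟩ := (readingNumber α).surjective p
    obtain ⟨b, rfl⟩ := (readingNumber α).surjective q
    rw [mem_inversions] at hpq
    rw [mem_inversions_symm_trans]
    refine ⟨hpq.1, ?_⟩
    have h1 : (α.index (u (readingNumber α b)) : ℕ) ≤ α.index (u (readingNumber α a)) :=
      monotone_index α hpq.2.le
    rw [hu', hu'] at h1
    have h2 := hr a
    have h3 := hr b
    have h4 := (readingNumber_lt a b).1 hpq.1
    rw [sourceSIT_lt]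
    omega

/-! ### The maximum of the class -/

theorem mem_iff_of_isUpperSet {U : Finset (Fin n)} (hU : ∀ p q, p ∈ U → p < q → q ∈ U) (p : Fin n) :
    p ∈ U ↔ n - U.card ≤ (p : ℕ) := by
  constructor
  · intro hp
    have : Finset.Ici p ⊆ U := by
      intro q hq
      rcases (Finset.mem_Ici.1 hq).lt_or_eq with h | h
      · exact hU p q hp h
      · exact h ▸ hp
    have := Finset.card_le_card this
    rw [Fin.card_Ici] at this
    omega
  · intro h
    by_contra hp
    have : U ⊆ Finset.Ioi p := by
      intro q hq
      rw [Finset.mem_Ioi]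
      by_contra hc
      rcases (not_lt.1 hc).lt_or_eq with h | h
      · exact hp (hU q p hq h)
      · exact hp (h ▸ hq)
    have := Finset.card_le_card this
    rw [Fin.card_Ioi] at this
    omega

/-- The first column is read last and has one box per row. -/
theorem col_eq_one_iff (b : compDiagram α) :
    b.1.1 = 1 ↔ n - α.length ≤ (reading'Number α b : ℕ) := by
  let U : Finset (Fin n) :=
    (Finset.univ.filter fun b : compDiagram α => b.1.1 = 1).map (reading'Number α).toEmbedding
  have hmem (a : compDiagram α) : reading'Number α a ∈ U ↔ a.1.1 = 1 := by simp [U]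
  have hcard : U.card = α.length := by
    rw [Finset.card_map, ← Fintype.card_fin α.length, ← Finset.card_univ]
    refine (Finset.card_nbij
      (fun i : Fin α.length => (⟨(1, (i : ℕ) + 1),
        mem_compDiagram.2 ⟨i, rfl, le_rfl, α.one_le_blocksFun i⟩⟩ : compDiagram α))
      (fun i _ => by simp) (fun i _ j _ h => ?_) (fun b hb => ?_)).symm
    · exact Fin.ext (by simpa using h)
    · obtain ⟨i, h1, -, -⟩ := mem_compDiagram.1 b.2
      have h2 : b.1.1 = 1 := by simpa using hb
      exact ⟨i, by simp, Subtype.ext (Prod.ext h2.symm h1.symm)⟩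
  rw [← hmem, ← hcard]
  refine mem_iff_of_isUpperSet (fun p q hp hpq => ?_) _
  obtain ⟨a, rfl⟩ := (reading'Number α).surjective p
  obtain ⟨b, rfl⟩ := (reading'Number α).surjective q
  rw [hmem] at hp ⊢
  rw [reading'Number_lt] at hpq
  omega

theorem w1_eq : w1 {i : Fin (n - 1) | (i : ℕ) + 1 ≤ n - α.length} =
    (reading'Number α).symm.trans (sinkSIT α) := by
  refine longest_eq _ ?_ ?_
  · intro i hi'
    rw [mem_rightDescents] at hi'
    rw [compl_compl, Set.mem_ofPred_eq]
    by_contra hc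
    obtain ⟨a, ha⟩ := (reading'Number α).surjective (lo i)
    obtain ⟨b, hb⟩ := (reading'Number α).surjective (hi i)
    have hab : reading'Number α a < reading'Number α b := by
      rw [ha, hb]
      exact lo_lt_hi i
    have ha1 : a.1.1 = 1 := (col_eq_one_iff a).2 (by rw [ha]; simp only [lo]; omega)
    have hb1 : b.1.1 = 1 := (col_eq_one_iff b).2 (by rw [hb]; simp only [hi]; omega)
    rw [← ha, ← hb, Equiv.trans_apply, Equiv.trans_apply, Equiv.symm_apply_apply,
      Equiv.symm_apply_apply, sinkSIT_lt] at hi'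
    rw [reading'Number_lt] at hab
    omega
  · rintro z hz ⟨p, q⟩ hpq
    rw [mem_inversions] at hpq
    -- A permutation without descents beyond `n - α.length` increases on the last `α.length` places.
    -- The earlier place of an inversion is thus a box outside the first column, and the sink
    -- inverts every such pair.
    have hp : (p : ℕ) < n - α.length := by
      by_contra hc
      refine hpq.2.asymm (rel_of_adjacent (r := (· < ·)) (fun h1 h2 => h1.trans h2) z hpq.1
        fun x y hx hxy _ => ?_)
      obtain ⟨i, rfl, rfl⟩ := exists_lo_hi hxy
      have hni : i ∉ rightDescents z := by
        intro h
        have h' := hz h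
        rw [compl_compl, Set.mem_ofPred_eq] at h'
        have hx' : (p : ℕ) ≤ i := hx
        omega
      rw [mem_rightDescents, not_lt] at hni
      exact lt_of_le_of_ne hni fun h => (lo_lt_hi i).ne (z.injective h)
    obtain ⟨a, rfl⟩ := (reading'Number α).surjective p
    obtain ⟨b, rfl⟩ := (reading'Number α).surjective q
    rw [mem_inversions_symm_trans]
    have ha : a.1.1 ≠ 1 := by
      rw [Ne, col_eq_one_iff]
      omega
    have h := (reading'Number_lt a b).1 hpq.1
    refine ⟨hpq.1, ?_⟩
    rw [sinkSIT_lt]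
    omega

end WeakBruhat

theorem mainTheorem6 (n : ℕ) (hn : 0 < n) (α : Composition n) :
    -- the reading words of the standard immaculate tableaux form a weak Bruhat interval
    WeakBruhat.IsInterval (WeakBruhat.readingWords α) ∧
    -- description of the class
    WeakBruhat.immaculateClass α =
      {I | ∃ T : WeakBruhat.StandardTableau n
            (WeakBruhat.reflect (WeakBruhat.immaculateDiagram α)),
          I = WeakBruhat.sigmaL (WeakBruhat.diagramPoset (WeakBruhat.reflectFilling T.1))} ∧
    -- minimum of the class
    (WeakBruhat.leftInterval (WeakBruhat.w0 (WeakBruhat.compSet α)ᶜ)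
        (WeakBruhat.readBy WeakBruhat.keyRLBT (WeakBruhat.sinkSIT α)) ∈
        WeakBruhat.immaculateClass α ∧
      ∀ J ∈ WeakBruhat.immaculateClass α,
        WeakBruhat.IntervalLE
          (WeakBruhat.leftInterval (WeakBruhat.w0 (WeakBruhat.compSet α)ᶜ)
            (WeakBruhat.readBy WeakBruhat.keyRLBT (WeakBruhat.sinkSIT α))) J) ∧
    -- maximum of the class
    (WeakBruhat.leftInterval (WeakBruhat.readBy WeakBruhat.keyRLBTBT (WeakBruhat.sourceSIT α))
        (WeakBruhat.w1 {i : Fin (n - 1) | (i : ℕ) + 1 ≤ n - α.length}) ∈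
        WeakBruhat.immaculateClass α ∧
      ∀ J ∈ WeakBruhat.immaculateClass α,
        WeakBruhat.IntervalLE J
          (WeakBruhat.leftInterval
            (WeakBruhat.readBy WeakBruhat.keyRLBTBT (WeakBruhat.sourceSIT α))
            (WeakBruhat.w1 {i : Fin (n - 1) | (i : ℕ) + 1 ≤ n - α.length}))) ∧
    -- isomorphism of posets
    IsPartialOrder (WeakBruhat.immaculateClass α)
      (fun I J => WeakBruhat.IntervalLE (I : Set (Equiv.Perm (Fin n))) J) ∧
    IsPartialOrder
      (WeakBruhat.StandardTableau n (WeakBruhat.reflect (WeakBruhat.immaculateDiagram α)))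
      WeakBruhat.TableauLE ∧
    Nonempty
      ((fun I J : WeakBruhat.immaculateClass α =>
          WeakBruhat.IntervalLE (I : Set (Equiv.Perm (Fin n))) J) ≃r
        (WeakBruhat.TableauLE : WeakBruhat.StandardTableau n
            (WeakBruhat.reflect (WeakBruhat.immaculateDiagram α)) → _ → Prop)) := by
  open WeakBruhat in
  have hmin : leftInterval (w0 (compSet α)ᶜ) (readBy keyRLBT (sinkSIT α)) =
      words (readingNumber α) := by
    rw [w0_eq, words_eq_leftInterval isAdmissible_readingNumber]
    rfl
  have hmax : leftInterval (readBy keyRLBTBT (sourceSIT α))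
      (w1 {i : Fin (n - 1) | (i : ℕ) + 1 ≤ n - α.length}) = words (reading'Number α) := by
    rw [w1_eq, words_eq_leftInterval isAdmissible_reading'Number]
    rfl
  rw [hmin, hmax]
  refine ⟨readingWords_eq ▸ isInterval_words isAdmissible_readingNumber,
    immaculateClass_eq_sigmaL,
    ⟨words_mem_immaculateClass isAdmissible_readingNumber, fun J hJ => ?_⟩,
    ⟨words_mem_immaculateClass isAdmissible_reading'Number, fun J hJ => ?_⟩,
    isPartialOrder_immaculateClass, isPartialOrder_tableauLE, ⟨classRelIso α⟩⟩
  -- Relative to the source, `readingNumber` inverts only pairs within a row, which every admissible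
  -- numbering inverts.
  · obtain ⟨L, hL, rfl⟩ := immaculateClass_eq.subset hJ
    rw [intervalLE_words' isAdmissible_readingNumber hL]
    intro a b h1 h2
    have hb := one_le_col a
    rw [sourceSIT_lt] at h1
    rw [readingNumber_lt] at h2
    exact hL.lt (by omega) (by omega) (ne_of_pos_ne (by omega))
  -- A pair in source order that `reading'Number` does not invert is in an order forced by
  -- admissibility, so no admissible `L` inverts it.
  · obtain ⟨L, hL, rfl⟩ := immaculateClass_eq.subset hJ
    rw [intervalLE_words' hL isAdmissible_reading'Number]
    intro a b h1 h2
    by_contra hc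
    have hb := one_le_col b
    have ha := one_le_col a
    rw [sourceSIT_lt] at h1
    rw [reading'Number_lt] at hc
    exact h2.asymm (hL.lt (by omega) (by omega) (ne_of_pos_ne (by omega)))
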